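/- For odd $n\ge 1$, $k\in\{0,1,2,\dots\}$ and a choice of sign, consider on $\mathbb R^2$ the vector field $$X_n=-ny^{2n-1}\partial_x+nx^{2n-1}\partial_y\pm n\left(x^ny^{n-1}(x^{2n}+y^{2n})^k\partial_x+x^{n-1}y^n(x^{2n}+y^{2n})^k\partial_y\right).$$ For bounded $A\subset\mathbb R^2$ put $A_\varepsilon=\{p: d(p,A)<\varepsilon\}$ and, for $s\ge 0$, $\mathcal M_*^s(A)=\liminf_{\varepsilon\to0^+}|A_\varepsilon|/\varepsilon^{2-s}$, $\mathcal M^{*s}(A)=\limsup_{\varepsilon\to0^+}|A_\varepsilon|/\varepsilon^{2-s}$. Write $\dim_BA=d$ if $\inf\{s\ge0:\mathcal M_*^s(A)=0\}=\inf\{s\ge0:\mathcal M^{*s}(A)=0\}=d$. The set $A$ is Minkowski nondegenerate if $0<\mathcal M_*^d(A)\le\mathcal M^{*d}(A)<\infty$ for some $d\ge0$, and Minkowski measurable if $\mathcal M_*^d(A)=\mathcal M^{*d}(A)\in(0,\infty)$ for some $d\ge0$. Theorem. Let $\gamma:J\to\mathbb R^2$ be a maximal solution of $\dot\gamma=X_n(\gamma)$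 ($J$ an open interval), let $t_0\in J$ with $\gamma(t_0)\ne0$. In the case of the sign $-$ (stable focus) $[t_0,\infty)\subset J$, and we put $\tilde\Gamma=\gamma([t_0,\infty))$; in the case of the sign $+$ (unstable focus) $(-\infty,t_0]\subset J$, and we put $\tilde\Gamma=\gamma((-\infty,t_0])$. Let $\varphi_0\in\mathbb R$ be any polar angle of $\gamma(t_0)$. Then $\tilde\Gamma$ is a bounded set and a spiral of focus type with the equation $r=f(\varphi)$ in standard polar coordinates, $\varphi\in I$, where $I=[\varphi_0,\infty)$ for the sign $-$ (positive orientation) and $I=(-\infty,\varphi_0]$ for the sign $+$ (negative orientation). Here $f:I\to(0,\infty)$ is continuous with $f(\varphi_0)=|\gamma(t_0)|$, $f(\varphi)\to0$ as $\varphi\to+\infty$ (resp. $\varphi\to-\infty$), and $f(\varphi+2\pi)<f(\varphi)$ (resp. $f(\varphi-2\pi)<f(\varphi)$) for $\varphi\in I$. Moreover: 1. If $k=0$, then $\tilde\Gamma$ is comparable with the exponential spiral $r=e^{\pm\varphi/n}$ (the same sign as in $X_n$): there are $A,B>0$ with $f(\varphi)/e^{\pm\varphi/n}\in[A,B]$ for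 all $\varphi\in I\cap[0,\infty)$ (sign $-$), resp. $\varphi\in I\cap(-\infty,0]$ (sign $+$). Furthermore $\dim_B\tilde\Gamma=1$ and $\tilde\Gamma$ is Minkowski measurable. 2. If $k>0$, then $\tilde\Gamma$ is comparable with the power spiral $r=\varphi^{-1/(2nk)}$: there are $A,B>0$ with $f(\varphi)/|\varphi|^{-1/(2nk)}\in[A,B]$ for all $\varphi\in I\cap[1,\infty)$ (sign $-$), resp. $\varphi\in I\cap(-\infty,-1]$ (sign $+$). Furthermore $\tilde\Gamma$ is Minkowski nondegenerate, and $$\dim_B\tilde\Gamma=2-\frac{2}{1+2kn}.$$ -/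

import Mathlib

open Set Filter Topology MeasureTheory
open scoped NNReal ENNReal

noncomputable section

namespace DegenerateFocus

/-! Minkowski contents and box dimension in `ℝ^N`. The `ε`-neighbourhood `{y | d(y, A) < ε}` of `A`
is `Metric.thickening ε A`, and `volume` is Lebesgue measure. -/

/-- Lower `s`-dimensional Minkowski content `liminf_{ε → 0+} |A_ε| / ε^(N - s)`. -/
def lowerMinkowskiContent {N : ℕ} (s : ℝ) (A : Set (EuclideanSpace ℝ (Fin N))) : ℝ≥0∞ :=
  liminf (fun ε : ℝ => volume (Metric.thickening ε A) / ENNReal.ofReal (ε ^ ((N : ℝ) - s)))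
    (𝓝[>] 0)

/-- Upper `s`-dimensional Minkowski content `limsup_{ε → 0+} |A_ε| / ε^(N - s)`. -/
def upperMinkowskiContent {N : ℕ} (s : ℝ) (A : Set (EuclideanSpace ℝ (Fin N))) : ℝ≥0∞ :=
  limsup (fun ε : ℝ => volume (Metric.thickening ε A) / ENNReal.ofReal (ε ^ ((N : ℝ) - s)))
    (𝓝[>] 0)

/-- Lower box dimension `inf {s ≥ 0 | M_*^s(A) = 0}` (with `inf ∅ = ∞`). -/
def lowerBoxDim {N : ℕ} (A : Set (EuclideanSpace ℝ (Fin N))) : ℝ≥0∞ :=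
  ⨅ (s : ℝ≥0) (_ : lowerMinkowskiContent (s : ℝ) A = 0), (s : ℝ≥0∞)

/-- Upper box dimension `inf {s ≥ 0 | M^{*s}(A) = 0}` (with `inf ∅ = ∞`). -/
def upperBoxDim {N : ℕ} (A : Set (EuclideanSpace ℝ (Fin N))) : ℝ≥0∞ :=
  ⨅ (s : ℝ≥0) (_ : upperMinkowskiContent (s : ℝ) A = 0), (s : ℝ≥0∞)

/-- The box dimension of the bounded set `A` exists and equals the real number `d ≥ 0`. -/
def HasBoxDim {N : ℕ} (A : Set (EuclideanSpace ℝ (Fin N))) (d : ℝ) : Prop :=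
  Bornology.IsBounded A ∧ 0 ≤ d ∧
    lowerBoxDim A = ENNReal.ofReal d ∧ upperBoxDim A = ENNReal.ofReal d

/-- `0 < M_*^d(A) ≤ M^{*d}(A) < ∞` for some `d ≥ 0`. -/
def IsMinkowskiNondegenerate {N : ℕ} (A : Set (EuclideanSpace ℝ (Fin N))) : Prop :=
  ∃ d : ℝ, 0 ≤ d ∧ 0 < lowerMinkowskiContent d A ∧
    lowerMinkowskiContent d A ≤ upperMinkowskiContent d A ∧ upperMinkowskiContent d A < ∞

/-- The Minkowski content `M^d(A)` exists and lies in `(0, ∞)` for some `d ≥ 0`. -/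
def IsMinkowskiMeasurable {N : ℕ} (A : Set (EuclideanSpace ℝ (Fin N))) : Prop :=
  ∃ d : ℝ, 0 ≤ d ∧ lowerMinkowskiContent d A = upperMinkowskiContent d A ∧
    0 < lowerMinkowskiContent d A ∧ lowerMinkowskiContent d A < ∞

/-! The vector field and its trajectories. -/

/-- The vector field `X + σ n (x^n y^(n-1) (x^(2n) + y^(2n))^k ∂x + x^(n-1) y^n (x^(2n) + y^(2n))^k ∂y)`
with `X = -n y^(2n-1) ∂x + n x^(2n-1) ∂y`; the sign `±` is `σ = 1` or `σ = -1`. -/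
def field (n k : ℕ) (σ : ℝ) (p : EuclideanSpace ℝ (Fin 2)) : EuclideanSpace ℝ (Fin 2) :=
  !₂[-(n : ℝ) * p 1 ^ (2 * n - 1)
        + σ * n * (p 0 ^ n * p 1 ^ (n - 1) * (p 0 ^ (2 * n) + p 1 ^ (2 * n)) ^ k),
     (n : ℝ) * p 0 ^ (2 * n - 1)
        + σ * n * (p 0 ^ (n - 1) * p 1 ^ n * (p 0 ^ (2 * n) + p 1 ^ (2 * n)) ^ k)]

/-- `γ` restricted to `J` solves `γ' = v(γ)`, where `J` is an open interval. -/
structure IsSolutionOn (v : EuclideanSpace ℝ (Fin 2) → EuclideanSpace ℝ (Fin 2))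
    (J : Set ℝ) (γ : ℝ → EuclideanSpace ℝ (Fin 2)) : Prop where
  isOpen : IsOpen J
  ordConnected : J.OrdConnected
  hasDerivAt : ∀ t ∈ J, HasDerivAt γ (v (γ t)) t

/-- `γ` is a maximal solution of `γ' = v(γ)`, and `J` is its maximal interval of existence. -/
structure IsMaximalSolution (v : EuclideanSpace ℝ (Fin 2) → EuclideanSpace ℝ (Fin 2))
    (J : Set ℝ) (γ : ℝ → EuclideanSpace ℝ (Fin 2)) : Prop where
  isSolutionOn : IsSolutionOn v J γ
  maximal : ∀ (J' : Set ℝ) (γ' : ℝ → EuclideanSpace ℝ (Fin 2)),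
    IsSolutionOn v J' γ' → J ⊆ J' → EqOn γ' γ J → J' ⊆ J

/-! Spirals in polar coordinates. -/

/-- The point with polar coordinates `(r, φ)`. -/
def polarPoint (r φ : ℝ) : EuclideanSpace ℝ (Fin 2) :=
  !₂[r * Real.cos φ, r * Real.sin φ]

/-- `Γ` is the positively oriented spiral of focus type `r = f(φ)`, `φ ∈ [φ₀, ∞)`: `f` is
continuous and positive, decreases along each ray and tends to `0` as `φ → ∞`. -/
structure IsPosFocusSpiral (Γ : Set (EuclideanSpace ℝ (Fin 2))) (φ₀ : ℝ) (f : ℝ → ℝ) : Prop where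
  continuousOn : ContinuousOn f (Ici φ₀)
  pos : ∀ φ ∈ Ici φ₀, 0 < f φ
  decreasing : ∀ φ ∈ Ici φ₀, f (φ + 2 * Real.pi) < f φ
  tendsto : Tendsto f atTop (𝓝 0)
  eq_image : Γ = (fun φ => polarPoint (f φ) φ) '' Ici φ₀

/-- `Γ` is the negatively oriented spiral of focus type `r = f(φ)`, `φ ∈ (-∞, φ₀]`: `f` is
continuous and positive, decreases along each ray and tends to `0` as `φ → -∞`. -/
structure IsNegFocusSpiral (Γ : Set (EuclideanSpace ℝ (Fin 2))) (φ₀ : ℝ) (f : ℝ → ℝ) : Prop where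
  continuousOn : ContinuousOn f (Iic φ₀)
  pos : ∀ φ ∈ Iic φ₀, 0 < f φ
  decreasing : ∀ φ ∈ Iic φ₀, f (φ - 2 * Real.pi) < f φ
  tendsto : Tendsto f atBot (𝓝 0)
  eq_image : Γ = (fun φ => polarPoint (f φ) φ) '' Iic φ₀

/-- `f / g` takes values in some `[A, B]` with `A, B > 0` on the set `I`. -/
def ComparableOn (I : Set ℝ) (f g : ℝ → ℝ) : Prop :=
  ∃ A B : ℝ, 0 < A ∧ 0 < B ∧ ∀ φ ∈ I, f φ / g φ ∈ Icc A B

/-- The positively oriented spiral `r = f(φ)`, `φ ∈ [φ₀, ∞)`, is comparable with the power spiral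
`r = φ^(-α)`: the ratio is bounded and bounded away from `0` on the part of `[1, ∞)` where the
spiral is defined (all of `[1, ∞)` as soon as `φ₀ ≤ 1`). -/
def PosComparablePower (φ₀ : ℝ) (f : ℝ → ℝ) (α : ℝ) : Prop :=
  ComparableOn (Ici φ₀ ∩ Ici 1) f (fun φ => |φ| ^ (-α))

/-- The negatively oriented spiral `r = f(φ)`, `φ ∈ (-∞, φ₀]`, is comparable with the power
spiral `r = |φ|^(-α)`; here `φ` ranges over `(-∞, -1]`. -/
def NegComparablePower (φ₀ : ℝ) (f : ℝ → ℝ) (α : ℝ) : Prop :=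
  ComparableOn (Iic φ₀ ∩ Iic (-1)) f (fun φ => |φ| ^ (-α))

/-- The positively oriented spiral `r = f(φ)`, `φ ∈ [φ₀, ∞)`, is comparable with the exponential
spiral `r = e^(-βφ)`, where `β > 0`; here `φ` ranges over `[0, ∞)`. -/
def PosComparableExp (φ₀ : ℝ) (f : ℝ → ℝ) (β : ℝ) : Prop :=
  0 < β ∧ ComparableOn (Ici φ₀ ∩ Ici 0) f (fun φ => Real.exp (-β * φ))

/-- The negatively oriented spiral `r = f(φ)`, `φ ∈ (-∞, φ₀]`, is comparable with the exponential
spiral `r = e^(-βφ)`, where `β < 0`; here `φ` ranges over `(-∞, 0]`. -/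
def NegComparableExp (φ₀ : ℝ) (f : ℝ → ℝ) (β : ℝ) : Prop :=
  β < 0 ∧ ComparableOn (Iic φ₀ ∩ Iic 0) f (fun φ => Real.exp (-β * φ))

end DegenerateFocus

end

/-! Write `H = x^(2n) + y^(2n)`. The unperturbed field preserves `H`, and the perturbation is the
radial vector `(xy)^(n-1) H^k (x, y)` up to the factor `± n`. So the polar angle always advances at
the rate `n H / r^2`, whatever the sign, and only the radius feels the perturbation. Since `n` is
odd, `n - 1` is even, and the generalized angle `u = arctan (tan φ ^ n)`, continued along the whole
line, is nondecreasing in `φ`. Along trajectories of the stable focus `dH/du = -2 H^(k+1)`. This is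
solved explicitly: `H` is a multiple of `exp (-2u)` if `k = 0`, and `H^(-k)` is affine in `u` with
slope `2k` if `k > 0`.

Hence `r = (H / (cos^(2n) φ + sin^(2n) φ))^(1/(2n))` is an explicit function of `φ`. As `u - φ` is
periodic, it is bounded, and `r` is comparable with `exp (-φ/n)` or with `φ^(-α)`, `α = 1/(2nk)`. A
time change turns this curve into a solution for all future times (`exists_time_change`), and
uniqueness identifies it with the given maximal solution (`IsMaximalSolution.forward`).

For `k = 0` the spiral has finite length. Normal coordinates show that a simple regular arc has
one-dimensional content equal to twice its length (`IsFramedCurve.tendsto_volume_thickening`). The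
rest of the spiral is short, hence contributes at most a small multiple of its length, so the lower
and upper contents agree.

For `k > 0` consecutive turns at angle `φ` are at distance at most of order `φ^(-1-α)`, which drops
below `ε` at `φ ~ ε^(-1/(1+α))`. The turns beyond that angle fill, up to `ε`, a disc of radius of
order `φ^(-α)`. The earlier part has length of order at most `φ^(1-α)`, where `α < 1`. Both areas
have order `ε^(2α/(1+α))`, which gives nondegeneracy and the dimension `2 - 2α/(1+α)`.

The unstable focus is the image of the stable one under reflection in the `x`-axis and time
reversal. -/

namespace DegenerateFocus

/-! ### Minkowski contents and box dimension -/

section Contents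

variable {N : ℕ} {A : Set (EuclideanSpace ℝ (Fin N))}

theorem lowerMinkowskiContent_le_upper (s : ℝ) (A : Set (EuclideanSpace ℝ (Fin N))) :
    lowerMinkowskiContent s A ≤ upperMinkowskiContent s A :=
  liminf_le_limsup

/-- Changing the exponent from `d` to `s` costs a factor `ε^(s - d)`, which tends to `0` for `s > d`
and is at least `1` for `s < d` and small `ε`. The next two lemmas are these two cases. -/
theorem thickening_div_eq_mul {ε : ℝ} (hε : 0 < ε) (V : ℝ≥0∞) (s d : ℝ) :
    V / ENNReal.ofReal (ε ^ ((N : ℝ) - s)) =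
      V / ENNReal.ofReal (ε ^ ((N : ℝ) - d)) * ENNReal.ofReal (ε ^ (s - d)) := by
  have h : ε ^ ((N : ℝ) - d) = ε ^ ((N : ℝ) - s) * ε ^ (s - d) := by
    rw [← Real.rpow_add hε]; congr 1; ring
  rw [h, ENNReal.ofReal_mul (by positivity), div_eq_mul_inv, div_eq_mul_inv,
    ENNReal.mul_inv (Or.inr ENNReal.ofReal_ne_top) (Or.inl ENNReal.ofReal_ne_top), mul_assoc, mul_assoc,
    ENNReal.inv_mul_cancel (by simpa using Real.rpow_pos_of_pos hε _) ENNReal.ofReal_ne_top,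
    mul_one]

theorem upperMinkowskiContent_eq_zero_of_lt {d s : ℝ} (hs : d < s)
    (h : upperMinkowskiContent d A < ∞) : upperMinkowskiContent s A = 0 := by
  obtain ⟨C, hC, hC'⟩ := exists_between h
  have hev := eventually_lt_of_limsup_lt hC
  have hlim : Tendsto (fun ε : ℝ => C * ENNReal.ofReal (ε ^ (s - d))) (𝓝[>] 0) (𝓝 0) := by
    have h1 : Tendsto (fun ε : ℝ => ε ^ (s - d)) (𝓝[>] 0) (𝓝 0) := by
      have := (Real.continuousAt_rpow_const 0 (s - d) (Or.inr (sub_pos.2 hs).le)).tendsto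
      rw [Real.zero_rpow (sub_pos.2 hs).ne'] at this
      exact this.mono_left nhdsWithin_le_nhds
    have h2 := ENNReal.Tendsto.const_mul (a := C) (ENNReal.tendsto_ofReal h1) (Or.inr hC'.ne)
    simpa using h2
  refine Tendsto.limsup_eq (tendsto_of_tendsto_of_tendsto_of_le_of_le' tendsto_const_nhds hlim
    (Eventually.of_forall fun _ => zero_le) ?_)
  filter_upwards [hev, self_mem_nhdsWithin] with ε h1 hε
  rw [thickening_div_eq_mul hε _ s d]
  gcongr

theorem lowerMinkowskiContent_pos_of_lt {d s : ℝ} (hs : s < d)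
    (h : 0 < lowerMinkowskiContent d A) : 0 < lowerMinkowskiContent s A := by
  obtain ⟨c, hc, hc'⟩ := exists_between h
  have hev := eventually_lt_of_lt_liminf hc'
  refine hc.trans_le (le_liminf_of_le (by isBoundedDefault) ?_)
  filter_upwards [hev, Ioo_mem_nhdsGT (zero_lt_one' ℝ)] with ε h1 hε
  rw [thickening_div_eq_mul hε.1 _ s d]
  calc c = c * 1 := (mul_one c).symm
    _ ≤ _ := by
      gcongr
      rw [ENNReal.one_le_ofReal]
      exact Real.one_le_rpow_of_pos_of_le_one_of_nonpos hε.1 hε.2.le (by linarith)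

/-- At a nondegenerate exponent `d` both contents vanish above `d` and are positive below it, so
both infima equal `d`. -/
theorem hasBoxDim_of_contents {d : ℝ} (hA : Bornology.IsBounded A) (hd : 0 ≤ d)
    (hl : 0 < lowerMinkowskiContent d A) (hu : upperMinkowskiContent d A < ∞) :
    HasBoxDim A d := by
  -- The value at `d` itself plays no role: vanishing above and nonvanishing below already fix the
  -- infimum.
  have key : ∀ F : ℝ → ℝ≥0∞, (∀ s, d < s → F s = 0) → (∀ s, s < d → F s ≠ 0) →
      (⨅ (s : ℝ≥0) (_ : F (s : ℝ) = 0), (s : ℝ≥0∞)) = ENNReal.ofReal d := by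
    intro F h1 h2
    apply le_antisymm
    · refine le_of_forall_gt_imp_ge_of_dense fun a ha => ?_
      obtain ⟨b, hb, hb'⟩ := ENNReal.lt_iff_exists_nnreal_btwn.1 ha
      refine (iInf₂_le b (h1 b ?_)).trans hb'.le
      by_contra! hle
      exact absurd hb (not_lt.2 (by simpa using ENNReal.ofReal_le_ofReal hle))
    · refine le_iInf₂ fun s hs => ?_
      by_contra! hlt
      refine h2 s ?_ hs
      by_contra! hle
      exact absurd hlt (not_lt.2 (ENNReal.ofReal_le_of_le_toReal (by simpa using hle)))
  refine ⟨hA, hd, key (fun s => lowerMinkowskiContent s A) (fun s hs => ?_) (fun s hs => ?_),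
    key (fun s => upperMinkowskiContent s A) (fun s hs => ?_) (fun s hs => ?_)⟩
  · exact le_antisymm ((lowerMinkowskiContent_le_upper s A).trans_eq
      (upperMinkowskiContent_eq_zero_of_lt hs hu)) zero_le
  · exact (lowerMinkowskiContent_pos_of_lt hs hl).ne'
  · exact upperMinkowskiContent_eq_zero_of_lt hs hu
  · exact ((lowerMinkowskiContent_pos_of_lt hs hl).trans_le
      (lowerMinkowskiContent_le_upper s A)).ne'

theorem lowerMinkowskiContent_pos_of_le {d c : ℝ} (hc : 0 < c)
    (h : ∀ᶠ ε : ℝ in 𝓝[>] 0,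
      ENNReal.ofReal (c * ε ^ ((N : ℝ) - d)) ≤ volume (Metric.thickening ε A)) :
    0 < lowerMinkowskiContent d A := by
  refine (ENNReal.ofReal_pos.2 hc).trans_le (le_liminf_of_le (by isBoundedDefault) ?_)
  filter_upwards [h, self_mem_nhdsWithin] with ε h1 (hε : 0 < ε)
  rw [ENNReal.ofReal_mul hc.le] at h1
  rwa [ENNReal.le_div_iff_mul_le (Or.inl (by simpa using Real.rpow_pos_of_pos hε _))
    (Or.inl ENNReal.ofReal_ne_top)]

theorem upperMinkowskiContent_lt_top_of_le {d C : ℝ} (hC : 0 ≤ C)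
    (h : ∀ᶠ ε : ℝ in 𝓝[>] 0,
      volume (Metric.thickening ε A) ≤ ENNReal.ofReal (C * ε ^ ((N : ℝ) - d))) :
    upperMinkowskiContent d A < ∞ := by
  refine lt_of_le_of_lt (limsup_le_of_le (by isBoundedDefault) ?_)
    (ENNReal.ofReal_lt_top (r := C))
  filter_upwards [h, self_mem_nhdsWithin] with ε h1 (hε : 0 < ε)
  rw [ENNReal.ofReal_mul hC] at h1
  exact ENNReal.div_le_of_le_mul h1

theorem volume_thickening_image_isometry
    (S : EuclideanSpace ℝ (Fin N) ≃ₗᵢ[ℝ] EuclideanSpace ℝ (Fin N)) (ε : ℝ)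
    (A : Set (EuclideanSpace ℝ (Fin N))) :
    volume (Metric.thickening ε (S '' A)) = volume (Metric.thickening ε A) := by
  have : Metric.thickening ε A = S ⁻¹' Metric.thickening ε (S '' A) := by
    ext x
    simp only [Metric.mem_thickening_iff, mem_preimage, exists_mem_image, S.dist_map]
  rw [this, (S.measurePreserving).measure_preimage
    Metric.isOpen_thickening.measurableSet.nullMeasurableSet]

theorem lowerMinkowskiContent_image_isometry
    (S : EuclideanSpace ℝ (Fin N) ≃ₗᵢ[ℝ] EuclideanSpace ℝ (Fin N)) (s : ℝ)
    (A : Set (EuclideanSpace ℝ (Fin N))) :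
    lowerMinkowskiContent s (S '' A) = lowerMinkowskiContent s A := by
  simp only [lowerMinkowskiContent, volume_thickening_image_isometry]

theorem upperMinkowskiContent_image_isometry
    (S : EuclideanSpace ℝ (Fin N) ≃ₗᵢ[ℝ] EuclideanSpace ℝ (Fin N)) (s : ℝ)
    (A : Set (EuclideanSpace ℝ (Fin N))) :
    upperMinkowskiContent s (S '' A) = upperMinkowskiContent s A := by
  simp only [upperMinkowskiContent, volume_thickening_image_isometry]

theorem HasBoxDim.image_isometry {d : ℝ} (h : HasBoxDim A d)
    (S : EuclideanSpace ℝ (Fin N) ≃ₗᵢ[ℝ] EuclideanSpace ℝ (Fin N)) :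
    HasBoxDim (S '' A) d := by
  obtain ⟨h1, h2, h3, h4⟩ := h
  refine ⟨S.lipschitz.isBounded_image h1, h2, ?_, ?_⟩
  · simpa only [lowerBoxDim, lowerMinkowskiContent_image_isometry] using h3
  · simpa only [upperBoxDim, upperMinkowskiContent_image_isometry] using h4

theorem IsMinkowskiNondegenerate.image_isometry (h : IsMinkowskiNondegenerate A)
    (S : EuclideanSpace ℝ (Fin N) ≃ₗᵢ[ℝ] EuclideanSpace ℝ (Fin N)) :
    IsMinkowskiNondegenerate (S '' A) := by
  simpa only [IsMinkowskiNondegenerate, lowerMinkowskiContent_image_isometry,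
    upperMinkowskiContent_image_isometry] using h

theorem IsMinkowskiMeasurable.image_isometry (h : IsMinkowskiMeasurable A)
    (S : EuclideanSpace ℝ (Fin N) ≃ₗᵢ[ℝ] EuclideanSpace ℝ (Fin N)) :
    IsMinkowskiMeasurable (S '' A) := by
  simpa only [IsMinkowskiMeasurable, lowerMinkowskiContent_image_isometry,
    upperMinkowskiContent_image_isometry] using h

end Contents

/-! ### Neighbourhoods of Lipschitz curves -/

/-- A curve of length at most `K (b - a)` in the plane has an `ε`-neighbourhood of area at most
`4π (K (b - a) + ε) ε`. -/
theorem volume_thickening_lipschitz_le {c : ℝ → EuclideanSpace ℝ (Fin 2)} {K a b ε : ℝ}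
    {S : Set ℝ} (hK : 0 < K) (hS : S ⊆ Icc a b) (hε : 0 < ε)
    (hc : ∀ x ∈ S, ∀ y ∈ S, dist (c x) (c y) ≤ K * |x - y|) :
    volume (Metric.thickening ε (c '' S)) ≤
      ENNReal.ofReal (4 * Real.pi * (K * (b - a) + ε) * ε) := by
  rcases S.eq_empty_or_nonempty with rfl | ⟨x₀, hx₀⟩
  · simp
  have hab : a ≤ b := (hS hx₀).1.trans (hS hx₀).2
  set M : ℕ := ⌊K * (b - a) / ε⌋₊ with hM
  -- The parameters are grouped into cells of length `ε / K`. The image of a cell has diameter at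
  -- most `ε`, so a ball of radius `2ε` about one of its points covers the `ε`-neighbourhood of that
  -- image.
  let cell : ℕ → Set ℝ := fun i => S ∩ {x | ⌊K * (x - a) / ε⌋₊ = i}
  classical
  let pt : ℕ → ℝ := fun i => if h : (cell i).Nonempty then h.some else x₀
  have hpt : ∀ i x, x ∈ cell i → pt i ∈ cell i := by
    intro i x hx
    have hne : (cell i).Nonempty := ⟨x, hx⟩
    simp only [pt, dif_pos hne]
    exact hne.some_mem
  have hsub : Metric.thickening ε (c '' S) ⊆
      ⋃ i ∈ Finset.range (M + 1), Metric.ball (c (pt i)) (2 * ε) := by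
    intro p hp
    obtain ⟨_, ⟨x, hx, rfl⟩, hpx⟩ := Metric.mem_thickening_iff.1 hp
    have hxc : x ∈ cell ⌊K * (x - a) / ε⌋₊ := ⟨hx, rfl⟩
    have hy := hpt _ x hxc
    set i := ⌊K * (x - a) / ε⌋₊ with hi
    refine mem_biUnion (x := i) ?_ ?_
    · simp only [Finset.coe_range, mem_Iio, Nat.lt_succ_iff, hi, hM]
      apply Nat.floor_le_floor
      have := (hS hx).2
      gcongr
    · have hxi : (i : ℝ) ≤ K * (x - a) / ε ∧ K * (x - a) / ε < i + 1 :=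
        (Nat.floor_eq_iff (by have := (hS hx).1; have : 0 ≤ x - a := by linarith
                              positivity)).1 hi.symm
      have hyi : (i : ℝ) ≤ K * (pt i - a) / ε ∧ K * (pt i - a) / ε < i + 1 :=
        (Nat.floor_eq_iff (by have := (hS hy.1).1; have : 0 ≤ pt i - a := by linarith
                              positivity)).1 hy.2
      rw [le_div_iff₀ hε, div_lt_iff₀ hε] at hxi hyi
      have hd : K * |x - pt i| ≤ ε := by
        rw [← abs_of_pos hK, ← abs_mul, abs_le]
        constructor <;> nlinarith [hxi.1, hxi.2, hyi.1, hyi.2]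
      have := hc x hx (pt i) hy.1
      rw [Metric.mem_ball]
      calc dist p (c (pt i)) ≤ dist p (c x) + dist (c x) (c (pt i)) := dist_triangle _ _ _
        _ < 2 * ε := by linarith
  refine (measure_mono hsub).trans ((measure_biUnion_finset_le _ _).trans ?_)
  simp only [EuclideanSpace.volume_ball_fin_two, Finset.sum_const, Finset.card_range, nsmul_eq_mul]
  have hMle : (M : ℝ) ≤ K * (b - a) / ε := Nat.floor_le (by
    have : 0 ≤ b - a := by linarith
    positivity)
  have hcast : ((M + 1 : ℕ) : ℝ≥0∞) * (ENNReal.ofReal (2 * ε) ^ 2 * ENNReal.ofReal Real.pi) =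
      ENNReal.ofReal (((M : ℝ) + 1) * ((2 * ε) ^ 2 * Real.pi)) := by
    rw [ENNReal.ofReal_mul (p := (M : ℝ) + 1) (by positivity),
      ENNReal.ofReal_mul (p := (2 * ε) ^ 2) (by positivity),
      ENNReal.ofReal_pow (by positivity), ← Nat.cast_succ, ENNReal.ofReal_natCast]
  rw [hcast]
  apply ENNReal.ofReal_le_ofReal
  rw [le_div_iff₀ hε] at hMle
  nlinarith [mul_le_mul_of_nonneg_right hMle (show 0 ≤ 4 * Real.pi * ε by positivity)]

/-! ### Normal coordinates and the content of a regular arc -/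

/-- The linear map of `ℝ × ℝ` with matrix `(α β; γ δ)`. -/
noncomputable def planeMap (α β γ δ : ℝ) : ℝ × ℝ →L[ℝ] ℝ × ℝ :=
  (α • ContinuousLinearMap.fst ℝ ℝ ℝ + β • ContinuousLinearMap.snd ℝ ℝ ℝ).prod
    (γ • ContinuousLinearMap.fst ℝ ℝ ℝ + δ • ContinuousLinearMap.snd ℝ ℝ ℝ)

theorem det_planeMap (α β γ δ : ℝ) : (planeMap α β γ δ).det = α * δ - β * γ := by
  rw [ContinuousLinearMap.det, ← LinearMap.det_toMatrix (Module.Basis.finTwoProd ℝ),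
    Matrix.det_fin_two]
  simp [LinearMap.toMatrix_apply, planeMap]

/-- The coordinates of a point of the plane, as a pair. -/
noncomputable def planeEquiv : EuclideanSpace ℝ (Fin 2) ≃ᵐ ℝ × ℝ :=
  (MeasurableEquiv.toLp 2 (Fin 2 → ℝ)).symm.trans MeasurableEquiv.finTwoArrow

theorem planeEquiv_apply (p : EuclideanSpace ℝ (Fin 2)) : planeEquiv p = (p 0, p 1) := rfl

theorem volume_image_planeEquiv (A : Set (EuclideanSpace ℝ (Fin 2))) :
    volume (planeEquiv '' A) = volume A := by
  have h : MeasurePreserving planeEquiv :=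
    (EuclideanSpace.volume_preserving_symm_measurableEquiv_toLp (Fin 2)).trans
      (volume_preserving_finTwoArrow ℝ)
  rw [← h.measure_preimage_equiv, planeEquiv.preimage_image]

theorem dist_sq_plane (p q : EuclideanSpace ℝ (Fin 2)) :
    dist p q ^ 2 = (p 0 - q 0) ^ 2 + (p 1 - q 1) ^ 2 := by
  rw [EuclideanSpace.dist_eq, Real.sq_sqrt (Finset.sum_nonneg fun _ _ => sq_nonneg _)]
  simp [Fin.sum_univ_two, Real.dist_eq, sq_abs]

theorem HasDerivAt.plane_apply {c : ℝ → EuclideanSpace ℝ (Fin 2)} {v : EuclideanSpace ℝ (Fin 2)}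
    {t : ℝ} (h : HasDerivAt c v t) (i : Fin 2) : HasDerivAt (fun t => c t i) (v i) t :=
  (EuclideanSpace.proj (𝕜 := ℝ) i).hasFDerivAt.comp_hasDerivAt t h

/-- A regular `C²` curve `c` of speed `g` with unit normal field `N`. -/
structure IsFramedCurve (c N w : ℝ → EuclideanSpace ℝ (Fin 2)) (g : ℝ → ℝ) : Prop where
  hasDerivAt : ∀ t, HasDerivAt c (!₂[g t * N t 1, -(g t * N t 0)]) t
  normal_hasDerivAt : ∀ t, HasDerivAt N (w t) t
  unit : ∀ t, N t 0 ^ 2 + N t 1 ^ 2 = 1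
  speed_pos : ∀ t, 0 < g t
  speed_continuous : Continuous g
  normal_deriv_continuous : Continuous w

namespace IsFramedCurve

variable {c N w : ℝ → EuclideanSpace ℝ (Fin 2)} {g : ℝ → ℝ}

/-- Normal coordinates along a curve. -/
def normalMap (c N : ℝ → EuclideanSpace ℝ (Fin 2)) (z : ℝ × ℝ) : ℝ × ℝ :=
  (c z.1 0 + z.2 * N z.1 0, c z.1 1 + z.2 * N z.1 1)

/-- The derivative of the normal coordinates. -/
noncomputable def normalDeriv (N w : ℝ → EuclideanSpace ℝ (Fin 2)) (g : ℝ → ℝ) (z : ℝ × ℝ) :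
    ℝ × ℝ →L[ℝ] ℝ × ℝ :=
  planeMap (g z.1 * N z.1 1 + z.2 * w z.1 0) (N z.1 0)
    (-(g z.1 * N z.1 0) + z.2 * w z.1 1) (N z.1 1)

theorem hasFDerivAt_normalMap (h : IsFramedCurve c N w g) (z : ℝ × ℝ) :
    HasFDerivAt (normalMap c N) (normalDeriv N w g z) z := by
  have key : ∀ i : Fin 2, ∀ v : ℝ, HasDerivAt (fun t => c t i) v z.1 →
      HasFDerivAt (fun z : ℝ × ℝ => c z.1 i + z.2 * N z.1 i)
        ((v + z.2 * w z.1 i) • ContinuousLinearMap.fst ℝ ℝ ℝ +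
          N z.1 i • ContinuousLinearMap.snd ℝ ℝ ℝ) z := by
    intro i v hv
    have h1 := hv.comp_hasFDerivAt z (hasFDerivAt_fst (𝕜 := ℝ) (p := z))
    have h2 := (HasDerivAt.plane_apply (h.normal_hasDerivAt z.1) i).comp_hasFDerivAt z
      (hasFDerivAt_fst (𝕜 := ℝ) (p := z))
    refine (h1.add ((hasFDerivAt_snd (𝕜 := ℝ) (p := z)).mul h2)).congr_fderiv ?_
    ext <;> simp
  exact (key 0 _ (HasDerivAt.plane_apply (h.hasDerivAt z.1) 0)).prodMk
    (key 1 _ (HasDerivAt.plane_apply (h.hasDerivAt z.1) 1))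

theorem continuous_normal (h : IsFramedCurve c N w g) : Continuous N :=
  continuous_iff_continuousAt.2 fun t => (h.normal_hasDerivAt t).continuousAt

theorem continuous_curve (h : IsFramedCurve c N w g) : Continuous c :=
  continuous_iff_continuousAt.2 fun t => (h.hasDerivAt t).continuousAt

theorem continuous_normalDeriv (h : IsFramedCurve c N w g) :
    Continuous (normalDeriv N w g) := by
  have h1 := h.continuous_normal
  have h2 := h.speed_continuous
  have h3 := h.normal_deriv_continuous
  have hN : ∀ i, Continuous fun z : ℝ × ℝ => N z.1 i := fun i => by fun_prop
  have hw : ∀ i, Continuous fun z : ℝ × ℝ => w z.1 i := fun i => by fun_prop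
  have hpm : Continuous fun q : ℝ × ℝ × ℝ × ℝ => planeMap q.1 q.2.1 q.2.2.1 q.2.2.2 := by
    let L : ℝ × ℝ × ℝ × ℝ →ₗ[ℝ] (ℝ × ℝ →L[ℝ] ℝ × ℝ) :=
      { toFun := fun q => planeMap q.1 q.2.1 q.2.2.1 q.2.2.2
        map_add' := fun p q => by ext <;> simp [planeMap]
        map_smul' := fun r q => by ext <;> simp [planeMap] }
    exact L.continuous_of_finiteDimensional
  exact hpm.comp (Continuous.prodMk (by fun_prop) (Continuous.prodMk (by fun_prop)
    (Continuous.prodMk (by fun_prop) (by fun_prop))))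

/-- The curvature term in the Jacobian of the normal coordinates. -/
def bend (N w : ℝ → EuclideanSpace ℝ (Fin 2)) (t : ℝ) : ℝ := w t 0 * N t 1 - w t 1 * N t 0

/-- The tangent is `g` times the unit normal turned by a right angle, so the part of the determinant
without `z.2` is `g |N|^2 = g`. -/
theorem det_normalDeriv (h : IsFramedCurve c N w g) (z : ℝ × ℝ) :
    (normalDeriv N w g z).det = g z.1 + z.2 * bend N w z.1 := by
  rw [normalDeriv, det_planeMap, bend]
  linear_combination g z.1 * h.unit z.1

/-- On the zero section the Jacobian is the speed, which is positive, so the inverse function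
theorem gives local injectivity there. Together with injectivity on the compact zero section this
extends to a neighbourhood of it, which contains a tube of uniform width. -/
theorem exists_injOn_normalMap (h : IsFramedCurve c N w g) {a b : ℝ} (hinj : InjOn c (Icc a b)) :
    ∃ δ > 0, InjOn (normalMap c N) (Icc a b ×ˢ Ioo (-δ) δ) := by
  have hc : IsCompact (Icc a b ×ˢ ({0} : Set ℝ)) := isCompact_Icc.prod isCompact_singleton
  have hi : InjOn (normalMap c N) (Icc a b ×ˢ ({0} : Set ℝ)) := by
    rintro ⟨x, s⟩ ⟨hx, rfl⟩ ⟨y, s'⟩ ⟨hy, rfl⟩ hxy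
    simp only [normalMap, zero_mul, add_zero, Prod.mk.injEq] at hxy
    have : c x = c y := by
      ext i
      fin_cases i
      · exact hxy.1
      · exact hxy.2
    exact Prod.ext (hinj hx hy this) rfl
  obtain ⟨U, hU, hUi⟩ := hi.exists_mem_nhdsSet hc
    (fun z _ => (h.hasFDerivAt_normalMap z).continuousAt) (by
      rintro ⟨x, s⟩ ⟨hx, rfl⟩
      have hs : HasStrictFDerivAt (normalMap c N) (normalDeriv N w g (x, 0)) (x, 0) :=
        hasStrictFDerivAt_of_hasFDerivAt_of_continuousAt
          (Eventually.of_forall h.hasFDerivAt_normalMap) h.continuous_normalDeriv.continuousAt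
      have hdet : (normalDeriv N w g (x, 0)).det ≠ 0 := by
        rw [h.det_normalDeriv]
        simpa using (h.speed_pos x).ne'
      set e := (normalDeriv N w g (x, 0)).toContinuousLinearEquivOfDetNeZero hdet
      have hs' : HasStrictFDerivAt (normalMap c N) (e : ℝ × ℝ →L[ℝ] ℝ × ℝ) (x, 0) := by
        rwa [ContinuousLinearMap.coe_toContinuousLinearEquivOfDetNeZero]
      exact ⟨_, (hs'.toOpenPartialHomeomorph _).open_source.mem_nhds
        hs'.mem_toOpenPartialHomeomorph_source, (hs'.toOpenPartialHomeomorph _).injOn⟩)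
  rw [isCompact_Icc.nhdsSet_prod_eq isCompact_singleton, nhdsSet_singleton] at hU
  obtain ⟨A, hA, B, hB, hAB⟩ := mem_prod_iff.1 hU
  obtain ⟨δ, hδ, hδB⟩ := Metric.mem_nhds_iff.1 hB
  refine ⟨δ, hδ, hUi.mono (Subset.trans (prod_mono (subset_of_mem_nhdsSet hA) ?_) hAB)⟩
  intro y hy
  exact hδB (by simpa [Real.ball_eq_Ioo] using hy)

/-- Length of the arc `c (a, b)`. -/
noncomputable def arcLength (g : ℝ → ℝ) (a b : ℝ) : ℝ≥0∞ :=
  ∫⁻ t in Ioo a b, ENNReal.ofReal (g t)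

theorem lintegral_fst_rectangle (F : ℝ → ℝ≥0∞) (hF : Measurable F) (a b ε : ℝ) :
    ∫⁻ z in Ioo a b ×ˢ Ioo (-ε) ε, F z.1 ∂(volume : Measure (ℝ × ℝ)) =
      ENNReal.ofReal (2 * ε) * ∫⁻ t in Ioo a b, F t := by
  rw [Measure.volume_eq_prod, ← Measure.prod_restrict,
    lintegral_prod (fun z => F z.1) (hF.comp measurable_fst).aemeasurable]
  simp only [lintegral_const, Measure.restrict_apply_univ, Real.volume_Ioo]
  rw [lintegral_mul_const _ hF, mul_comm]
  congr 2; ring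

theorem exists_bend_bound (h : IsFramedCurve c N w g) (a b : ℝ) :
    ∃ M : ℝ, 0 ≤ M ∧ ∀ t ∈ Icc a b, |bend N w t| ≤ M := by
  have h1 := h.continuous_normal
  have h3 := h.normal_deriv_continuous
  have hN : ∀ i, Continuous fun t : ℝ => N t i := fun i => by fun_prop
  have hw : ∀ i, Continuous fun t : ℝ => w t i := fun i => by fun_prop
  have hb : Continuous (bend N w) := by unfold bend; fun_prop
  obtain ⟨M, hM⟩ := isCompact_Icc.exists_bound_of_continuousOn (s := Icc a b) hb.continuousOn
  exact ⟨max M 0, le_max_right _ _, fun t ht => (hM t ht).trans (le_max_left _ _)⟩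

/-- Change of variables, where the Jacobian exceeds `g` by at most `ε M`. This direction needs no
injectivity. -/
theorem volume_image_normalMap_le (h : IsFramedCurve c N w g) {a b ε M : ℝ}
    (hM : ∀ t ∈ Icc a b, |bend N w t| ≤ M) (hM0 : 0 ≤ M) (hε : 0 < ε) :
    volume (normalMap c N '' (Ioo a b ×ˢ Ioo (-ε) ε)) ≤
      ENNReal.ofReal (2 * ε) * arcLength g a b +
        ENNReal.ofReal (2 * ε) * ENNReal.ofReal (ε * M * (b - a)) := by
  have hmeas : MeasurableSet (Ioo a b ×ˢ Ioo (-ε) ε) := measurableSet_Ioo.prod measurableSet_Ioo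
  have hgm : Measurable fun t => ENNReal.ofReal (g t) := h.speed_continuous.measurable.ennreal_ofReal
  refine (addHaar_image_le_lintegral_abs_det_fderiv volume hmeas
    (fun z _ => (h.hasFDerivAt_normalMap z).hasFDerivWithinAt)).trans ?_
  calc _ ≤ ∫⁻ z in Ioo a b ×ˢ Ioo (-ε) ε, (fun t => ENNReal.ofReal (g t) +
        ENNReal.ofReal (ε * M)) z.1 ∂(volume : Measure (ℝ × ℝ)) := by
        refine setLIntegral_mono' hmeas fun z hz => ?_
        rw [h.det_normalDeriv]
        simp only
        rw [← ENNReal.ofReal_add (h.speed_pos _).le (by positivity)]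
        apply ENNReal.ofReal_le_ofReal
        refine (abs_add_le _ _).trans ?_
        rw [abs_of_pos (h.speed_pos _), abs_mul]
        have h1 := hM z.1 (Ioo_subset_Icc_self hz.1)
        have h2 : |z.2| ≤ ε := (abs_lt.2 hz.2).le
        gcongr
    _ = _ := by
        rw [lintegral_fst_rectangle _ (hgm.add_const _), lintegral_add_left hgm, mul_add]
        congr 2
        rw [setLIntegral_const, Real.volume_Ioo, ← ENNReal.ofReal_mul (by positivity)]

theorem le_volume_image_normalMap (h : IsFramedCurve c N w g) {a b ε M : ℝ}
    (hM : ∀ t ∈ Icc a b, |bend N w t| ≤ M) (hM0 : 0 ≤ M) (hε : 0 < ε)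
    (hinj : InjOn (normalMap c N) (Ioo a b ×ˢ Ioo (-ε) ε)) :
    ENNReal.ofReal (2 * ε) * arcLength g a b ≤
      volume (normalMap c N '' (Ioo a b ×ˢ Ioo (-ε) ε)) +
        ENNReal.ofReal (2 * ε) * ENNReal.ofReal (ε * M * (b - a)) := by
  have hmeas : MeasurableSet (Ioo a b ×ˢ Ioo (-ε) ε) := measurableSet_Ioo.prod measurableSet_Ioo
  have hgm : Measurable fun t => ENNReal.ofReal (g t) := h.speed_continuous.measurable.ennreal_ofReal
  rw [← lintegral_abs_det_fderiv_eq_addHaar_image volume hmeas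
    (fun z _ => (h.hasFDerivAt_normalMap z).hasFDerivWithinAt) hinj, arcLength,
    ← lintegral_fst_rectangle _ hgm]
  have hconst : ENNReal.ofReal (2 * ε) * ENNReal.ofReal (ε * M * (b - a)) =
      ∫⁻ z in Ioo a b ×ˢ Ioo (-ε) ε, (fun _ => ENNReal.ofReal (ε * M)) z.1
        ∂(volume : Measure (ℝ × ℝ)) := by
    rw [lintegral_fst_rectangle _ measurable_const, setLIntegral_const, Real.volume_Ioo,
      ENNReal.ofReal_mul (p := ε * M) (by positivity)]
  rw [hconst, ← lintegral_add_right _ measurable_const]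
  refine setLIntegral_mono' hmeas fun z hz => ?_
  rw [h.det_normalDeriv, ← ENNReal.ofReal_add (abs_nonneg _) (by positivity)]
  apply ENNReal.ofReal_le_ofReal
  have h1 := hM z.1 (Ioo_subset_Icc_self hz.1)
  have h2 : |z.2| ≤ ε := (abs_lt.2 hz.2).le
  have h3 : |z.2 * bend N w z.1| ≤ ε * M := by rw [abs_mul]; gcongr
  have := le_abs_self (g z.1 + z.2 * bend N w z.1)
  have := neg_abs_le (z.2 * bend N w z.1)
  linarith

theorem image_normalMap_subset (h : IsFramedCurve c N w g) (a b ε : ℝ) :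
    normalMap c N '' (Ioo a b ×ˢ Ioo (-ε) ε) ⊆
      planeEquiv '' Metric.thickening ε (c '' Icc a b) := by
  rintro _ ⟨⟨t, s⟩, ⟨ht, hs⟩, rfl⟩
  refine ⟨c t + s • N t, ?_, ?_⟩
  · refine Metric.mem_thickening_iff.2 ⟨c t, mem_image_of_mem _ (Ioo_subset_Icc_self ht), ?_⟩
    have hd := dist_sq_plane (c t + s • N t) (c t)
    simp only [PiLp.add_apply, PiLp.smul_apply, smul_eq_mul, add_sub_cancel_left] at hd
    have hs2 : dist (c t + s • N t) (c t) ^ 2 = s ^ 2 := by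
      rw [hd]; linear_combination s ^ 2 * h.unit t
    have hs' := abs_lt.2 hs
    have := abs_nonneg s
    rw [← sq_abs s] at hs2
    have := (pow_left_inj₀ dist_nonneg this two_ne_zero).1 hs2
    linarith
  · simp [planeEquiv_apply, normalMap]

/-- A nearest point of the arc is either an endpoint, which the two discs account for, or an
interior point, where the segment from it is normal to the curve. -/
theorem thickening_subset (h : IsFramedCurve c N w g) (a b ε : ℝ) :
    planeEquiv '' Metric.thickening ε (c '' Icc a b) ⊆
      normalMap c N '' (Ioo a b ×ˢ Ioo (-ε) ε) ∪ planeEquiv '' Metric.ball (c a) ε ∪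
        planeEquiv '' Metric.ball (c b) ε := by
  rintro _ ⟨p, hp, rfl⟩
  obtain ⟨_, ⟨x, hx, rfl⟩, hpx⟩ := Metric.mem_thickening_iff.1 hp
  let F : ℝ → ℝ := fun t => (p 0 - c t 0) ^ 2 + (p 1 - c t 1) ^ 2
  have hFd : ∀ t, F t = dist p (c t) ^ 2 := fun t => (dist_sq_plane p (c t)).symm
  have hc := h.continuous_curve
  have hF : Continuous F := by
    have : ∀ i, Continuous fun t : ℝ => c t i := fun i => by fun_prop
    fun_prop
  obtain ⟨t, ht, hmin⟩ := isCompact_Icc.exists_isMinOn ⟨x, hx⟩ hF.continuousOn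
  have hdt : dist p (c t) < ε := by
    refine lt_of_le_of_lt ?_ hpx
    have := hmin hx
    simp only [mem_ofPred_eq, hFd] at this
    exact (pow_le_pow_iff_left₀ dist_nonneg dist_nonneg two_ne_zero).1 this
  rcases eq_or_lt_of_le ht.1 with rfl | hat
  · exact Or.inl (Or.inr ⟨p, hdt, rfl⟩)
  rcases eq_or_lt_of_le ht.2 with rfl | htb
  · exact Or.inr ⟨p, hdt, rfl⟩
  refine Or.inl (Or.inl ⟨(t, (p 0 - c t 0) * N t 0 + (p 1 - c t 1) * N t 1), ?_, ?_⟩)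
  all_goals
    have hd0 := ((HasDerivAt.plane_apply (h.hasDerivAt t) 0).const_sub (p 0)).pow 2
    have hd1 := ((HasDerivAt.plane_apply (h.hasDerivAt t) 1).const_sub (p 1)).pow 2
    -- The derivative of the squared distance vanishes at an interior minimum. This makes `p - c t`
    -- parallel to the normal, so its normal component is the required offset.
    have hz := (hmin.isLocalMin (Icc_mem_nhds hat htb)).hasDerivAt_eq_zero (hd0.add hd1)
    simp at hz
    have hperp : (p 0 - c t 0) * N t 1 = (p 1 - c t 1) * N t 0 := by
      have := (h.speed_pos t).ne'
      apply mul_left_cancel₀ this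
      linarith
  · refine ⟨⟨hat, htb⟩, abs_lt.1 (lt_of_pow_lt_pow_left₀ 2 (dist_nonneg.trans hdt.le) ?_)⟩
    have : dist p (c t) ^ 2 < ε ^ 2 := pow_lt_pow_left₀ hdt dist_nonneg two_ne_zero
    rw [dist_sq_plane] at this
    rw [sq_abs]
    refine lt_of_eq_of_lt ?_ this
    linear_combination ((p 0 - c t 0) ^ 2 + (p 1 - c t 1) ^ 2) * h.unit t -
      ((p 0 - c t 0) * N t 1 - (p 1 - c t 1) * N t 0) * hperp
  · simp only [normalMap, planeEquiv_apply, Prod.mk.injEq]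
    constructor
    · linear_combination (p 0 - c t 0) * h.unit t - N t 1 * hperp
    · linear_combination (p 1 - c t 1) * h.unit t + N t 0 * hperp

/-- The one-dimensional Minkowski content of a simple regular arc is twice its length. -/
theorem tendsto_volume_thickening (h : IsFramedCurve c N w g) {a b : ℝ} (hab : a ≤ b)
    (hinj : InjOn c (Icc a b)) :
    Tendsto (fun ε : ℝ => volume (Metric.thickening ε (c '' Icc a b)) / ENNReal.ofReal ε)
      (𝓝[>] 0) (𝓝 (2 * arcLength g a b)) := by
  obtain ⟨M, hM0, hM⟩ := h.exists_bend_bound a b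
  obtain ⟨δ, hδ, hδi⟩ := h.exists_injOn_normalMap hinj
  have hba : 0 ≤ b - a := sub_nonneg.2 hab
  have hlin : ∀ C : ℝ, Tendsto (fun ε : ℝ => ENNReal.ofReal (C * ε)) (𝓝[>] 0) (𝓝 0) := by
    intro C
    have : Tendsto (fun ε : ℝ => C * ε) (𝓝[>] 0) (𝓝 (C * 0)) :=
      ((continuous_const.mul continuous_id).tendsto 0).mono_left nhdsWithin_le_nhds
    simpa using ENNReal.tendsto_ofReal this
  have h2 : ∀ ε : ℝ, ENNReal.ofReal (2 * ε) = 2 * ENNReal.ofReal ε := fun ε => by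
    rw [ENNReal.ofReal_mul zero_le_two]; simp
  -- After division by `ε` the curvature error is at most `2M(b - a)ε` on either side, and the two
  -- end discs add `2πε` to the upper bound.
  refine tendsto_of_tendsto_of_tendsto_of_le_of_le'
    (g := fun ε => 2 * arcLength g a b - ENNReal.ofReal (2 * M * (b - a) * ε))
    (h := fun ε => 2 * arcLength g a b +
      ENNReal.ofReal ((2 * M * (b - a) + 2 * Real.pi) * ε)) ?_ ?_ ?_ ?_
  · have := ENNReal.Tendsto.sub (tendsto_const_nhds (x := 2 * arcLength g a b)
      (f := 𝓝[>] (0 : ℝ))) (hlin (2 * M * (b - a))) (Or.inr ENNReal.zero_ne_top)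
    simpa using this
  · simpa using tendsto_const_nhds (x := 2 * arcLength g a b).add
      (hlin (2 * M * (b - a) + 2 * Real.pi))
  · filter_upwards [Ioo_mem_nhdsGT hδ] with ε hε
    have hε0 : ENNReal.ofReal ε ≠ 0 := by simpa using hε.1
    rw [tsub_le_iff_right, ← ENNReal.mul_le_mul_iff_right hε0 ENNReal.ofReal_ne_top, mul_add,
      ENNReal.mul_div_cancel hε0 ENNReal.ofReal_ne_top]
    have h3 := h.le_volume_image_normalMap (ε := ε) hM hM0 hε.1
      (hδi.mono (prod_mono Ioo_subset_Icc_self (Ioo_subset_Ioo (neg_le_neg hε.2.le) hε.2.le)))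
    have h4 := measure_mono (μ := volume) (h.image_normalMap_subset a b ε)
    rw [volume_image_planeEquiv] at h4
    refine le_trans (le_of_eq ?_) (h3.trans (add_le_add h4 (le_of_eq ?_)))
    · rw [h2]; ring
    · rw [← ENNReal.ofReal_mul (by linarith [hε.1]), ← ENNReal.ofReal_mul hε.1.le]
      congr 1; ring
  · filter_upwards [self_mem_nhdsWithin] with ε (hε : 0 < ε)
    have hε0 : ENNReal.ofReal ε ≠ 0 := by simpa using hε
    refine ENNReal.div_le_of_le_mul ?_
    rw [← volume_image_planeEquiv]
    refine (measure_mono (h.thickening_subset a b ε)).trans ((measure_union_le _ _).trans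
      ((add_le_add_left (measure_union_le _ _) _).trans ?_))
    rw [volume_image_planeEquiv, volume_image_planeEquiv, EuclideanSpace.volume_ball_fin_two,
      EuclideanSpace.volume_ball_fin_two]
    refine (add_le_add_left (add_le_add_left (h.volume_image_normalMap_le hM hM0 hε) _) _).trans
      (le_of_eq ?_)
    have h5 : ENNReal.ofReal ε ^ 2 * ENNReal.ofReal Real.pi =
        ENNReal.ofReal ε * ENNReal.ofReal (Real.pi * ε) := by
      rw [← ENNReal.ofReal_pow hε.le, ← ENNReal.ofReal_mul (by positivity),
        ← ENNReal.ofReal_mul (by positivity)]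
      congr 1; ring
    have h6 : ENNReal.ofReal ((2 * M * (b - a) + 2 * Real.pi) * ε) =
        2 * ENNReal.ofReal (ε * M * (b - a)) + 2 * ENNReal.ofReal (Real.pi * ε) := by
      rw [← h2, ← h2, ← ENNReal.ofReal_add (by positivity) (by positivity)]
      congr 1; ring
    rw [h5, h6, h2]
    ring

end IsFramedCurve

/-! ### The generalized polar angle -/

/-- The value of `x^(2n) + y^(2n)` at the point of the unit circle with polar angle `φ`. -/
noncomputable def angularNorm (n : ℕ) (φ : ℝ) : ℝ := Real.cos φ ^ (2 * n) + Real.sin φ ^ (2 * n)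

/-- The derivative of `arctan (tan φ ^ n)`, extended to all `φ`. -/
noncomputable def angularSpeed (n : ℕ) (φ : ℝ) : ℝ :=
  n * (Real.cos φ * Real.sin φ) ^ (n - 1) / angularNorm n φ

/-- The variation of the generalized polar angle `arctan (tan φ ^ n)` between `φ₀` and `φ`. -/
noncomputable def generalizedAngle (n : ℕ) (φ₀ φ : ℝ) : ℝ := ∫ x in φ₀..φ, angularSpeed n x

theorem angularNorm_ge (n : ℕ) (φ : ℝ) : (1 / 2 : ℝ) ^ n ≤ angularNorm n φ := by
  rw [angularNorm, pow_mul, pow_mul]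
  have h := Real.cos_sq_add_sin_sq φ
  have hc := sq_nonneg (Real.cos φ)
  have hs := sq_nonneg (Real.sin φ)
  rcases le_total (1 / 2) (Real.cos φ ^ 2) with h1 | h1
  · have := pow_le_pow_left₀ (by norm_num) h1 n
    have := pow_nonneg hs n
    linarith
  · have := pow_le_pow_left₀ (by norm_num) (show 1 / 2 ≤ Real.sin φ ^ 2 by linarith) n
    have := pow_nonneg hc n
    linarith

theorem angularNorm_pos (n : ℕ) (φ : ℝ) : 0 < angularNorm n φ :=
  lt_of_lt_of_le (by positivity) (angularNorm_ge n φ)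

theorem angularNorm_le (n : ℕ) (φ : ℝ) : angularNorm n φ ≤ 2 := by
  rw [angularNorm, pow_mul, pow_mul]
  have := pow_le_one₀ (sq_nonneg _) (Real.cos_sq_le_one φ) (n := n)
  have := pow_le_one₀ (sq_nonneg _) (Real.sin_sq_le_one φ) (n := n)
  linarith

theorem continuous_angularNorm (n : ℕ) : Continuous (angularNorm n) := by
  unfold angularNorm; fun_prop

theorem continuous_angularSpeed (n : ℕ) : Continuous (angularSpeed n) := by
  have := continuous_angularNorm n
  unfold angularSpeed
  exact Continuous.div (by fun_prop) this fun φ => (angularNorm_pos n φ).ne'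

theorem angularNorm_add_two_pi (n : ℕ) (φ : ℝ) :
    angularNorm n (φ + 2 * Real.pi) = angularNorm n φ := by
  simp [angularNorm]

theorem hasDerivAt_angularNorm (n : ℕ) (φ : ℝ) :
    HasDerivAt (angularNorm n)
      (2 * n * (Real.sin φ ^ (2 * n - 1) * Real.cos φ - Real.cos φ ^ (2 * n - 1) * Real.sin φ))
      φ := by
  have h := ((Real.hasDerivAt_cos φ).pow (2 * n)).add ((Real.hasDerivAt_sin φ).pow (2 * n))
  refine h.congr_deriv ?_
  push_cast; ring

theorem angularSpeed_nonneg {n : ℕ} (hn : Odd n) (φ : ℝ) : 0 ≤ angularSpeed n φ := by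
  have := angularNorm_pos n φ
  have := (Nat.Odd.sub_odd hn odd_one).pow_nonneg (Real.cos φ * Real.sin φ)
  unfold angularSpeed; positivity

/-- A quarter turn exchanges cosine and sine up to a sign, which the even exponents `2n` and `n - 1`
remove. -/
theorem angularSpeed_periodic {n : ℕ} (hn : Odd n) :
    Function.Periodic (angularSpeed n) (Real.pi / 2) := by
  intro φ
  simp only [angularSpeed, angularNorm, Real.cos_add_pi_div_two, Real.sin_add_pi_div_two]
  rw [(even_two_mul n).neg_pow, neg_mul, (Nat.Odd.sub_odd hn odd_one).neg_pow, add_comm,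
    mul_comm (Real.sin φ)]

/-- The quarter period is centred at `0` because there `tan` has no pole and `arctan (tan x ^ n)` is
a genuine primitive, with values `± π/4` at the ends. -/
theorem integral_angularSpeed_quarter {n : ℕ} (hn : Odd n) :
    ∫ x in (-(Real.pi / 4))..(Real.pi / 4), angularSpeed n x = Real.pi / 2 := by
  have hpi := Real.pi_pos
  have hd : ∀ x ∈ uIcc (-(Real.pi / 4)) (Real.pi / 4),
      HasDerivAt (fun x => Real.arctan (Real.tan x ^ n)) (angularSpeed n x) x := by
    intro x hx
    rw [uIcc_of_le (by linarith)] at hx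
    have hc : 0 < Real.cos x :=
      Real.cos_pos_of_mem_Ioo ⟨by linarith [hx.1], by linarith [hx.2]⟩
    have h := ((Real.hasDerivAt_tan hc.ne').pow n).arctan
    refine h.congr_deriv ?_
    obtain ⟨m, rfl⟩ := hn
    have hden : 0 < 1 + (Real.tan x ^ (2 * m + 1)) ^ 2 := by positivity
    have hN := angularNorm_pos (2 * m + 1) x
    rw [angularSpeed]
    rw [Pi.pow_apply, one_div_mul_eq_div, div_eq_div_iff hden.ne' hN.ne', angularNorm, Real.tan_eq_sin_div_cos]
    have e : 2 * m + 1 - 1 = 2 * m := rfl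
    rw [e]
    simp only [div_pow, mul_pow]
    field_simp
    ring
  rw [intervalIntegral.integral_eq_sub_of_hasDerivAt hd
    (continuous_angularSpeed n).continuousOn.intervalIntegrable]
  simp only [Real.tan_neg, Real.tan_pi_div_four, hn.neg_one_pow, one_pow, Real.arctan_neg,
    Real.arctan_one]
  ring

theorem integral_angularSpeed_add {n : ℕ} (hn : Odd n) (φ : ℝ) :
    ∫ x in φ..(φ + Real.pi / 2), angularSpeed n x = Real.pi / 2 := by
  rw [(angularSpeed_periodic hn).intervalIntegral_add_eq φ (-(Real.pi / 4)),
    show -(Real.pi / 4) + Real.pi / 2 = Real.pi / 4 by ring, integral_angularSpeed_quarter hn]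

theorem generalizedAngle_self (n : ℕ) (φ₀ : ℝ) : generalizedAngle n φ₀ φ₀ = 0 :=
  intervalIntegral.integral_same

theorem hasDerivAt_generalizedAngle (n : ℕ) (φ₀ φ : ℝ) :
    HasDerivAt (generalizedAngle n φ₀) (angularSpeed n φ) φ :=
  intervalIntegral.integral_hasDerivAt_right
    (continuous_angularSpeed n).continuousOn.intervalIntegrable
    (continuous_angularSpeed n).aestronglyMeasurable.stronglyMeasurableAtFilter
    (continuous_angularSpeed n).continuousAt

theorem continuous_generalizedAngle (n : ℕ) (φ₀ : ℝ) : Continuous (generalizedAngle n φ₀) :=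
  continuous_iff_continuousAt.2 fun φ => (hasDerivAt_generalizedAngle n φ₀ φ).continuousAt

theorem generalizedAngle_nonneg {n : ℕ} (hn : Odd n) {φ₀ φ : ℝ} (h : φ₀ ≤ φ) : 0 ≤ generalizedAngle n φ₀ φ :=
  intervalIntegral.integral_nonneg h fun _ _ => angularSpeed_nonneg hn _

theorem generalizedAngle_add_pi_div_two {n : ℕ} (hn : Odd n) (φ₀ φ : ℝ) :
    generalizedAngle n φ₀ (φ + Real.pi / 2) = generalizedAngle n φ₀ φ + Real.pi / 2 := by
  have hi : ∀ a b, IntervalIntegrable (angularSpeed n) volume a b := fun a b =>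
    (continuous_angularSpeed n).continuousOn.intervalIntegrable
  rw [generalizedAngle, ← intervalIntegral.integral_add_adjacent_intervals (hi φ₀ φ) (hi _ _),
    integral_angularSpeed_add hn]
  rfl

theorem generalizedAngle_add_two_pi {n : ℕ} (hn : Odd n) (φ₀ φ : ℝ) :
    generalizedAngle n φ₀ (φ + 2 * Real.pi) = generalizedAngle n φ₀ φ + 2 * Real.pi := by
  have e : φ + 2 * Real.pi =
      φ + Real.pi / 2 + Real.pi / 2 + Real.pi / 2 + Real.pi / 2 := by ring
  rw [e]
  simp only [generalizedAngle_add_pi_div_two hn]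
  ring

/-- The angle gains exactly `π/2` on each quarter turn, so the difference is continuous and
periodic. This bound is what transfers asymptotics in the generalized angle to the polar angle. -/
theorem exists_generalizedAngle_bound {n : ℕ} (hn : Odd n) (φ₀ : ℝ) :
    ∃ M : ℝ, 0 ≤ M ∧ ∀ φ, |generalizedAngle n φ₀ φ - φ| ≤ M := by
  have hper : Function.Periodic (fun φ => generalizedAngle n φ₀ φ - φ) (Real.pi / 2) := by
    intro φ
    simp only [generalizedAngle_add_pi_div_two hn]
    ring
  have hc : Continuous fun φ => generalizedAngle n φ₀ φ - φ :=
    (continuous_generalizedAngle n φ₀).sub continuous_id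
  obtain ⟨M, hM⟩ := isCompact_Icc.exists_bound_of_continuousOn
    (s := Icc 0 (Real.pi / 2)) hc.continuousOn
  refine ⟨max M 0, le_max_right _ _, fun φ => ?_⟩
  obtain ⟨y, hy, hxy⟩ := hper.exists_mem_Ico₀ (by positivity) φ
  rw [hxy]
  exact (hM y (Ico_subset_Icc_self hy)).trans (le_max_left _ _)

theorem tendsto_generalizedAngle {n : ℕ} (hn : Odd n) (φ₀ : ℝ) : Tendsto (generalizedAngle n φ₀) atTop atTop := by
  obtain ⟨M, -, hM⟩ := exists_generalizedAngle_bound hn φ₀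
  refine tendsto_atTop_mono (fun φ => ?_) (tendsto_atTop_add_const_right atTop (-M) tendsto_id)
  have := (abs_le.1 (hM φ)).1
  simp only [id]
  linarith

/-! ### Uniqueness and change of time -/

theorem contDiff_field (n k : ℕ) (σ : ℝ) : ContDiff ℝ 2 (field n k σ) := by
  have h : ∀ i : Fin 2, ContDiff ℝ 2 fun p : EuclideanSpace ℝ (Fin 2) => p i := fun i =>
    (EuclideanSpace.proj (𝕜 := ℝ) i).contDiff
  have h0 := h 0
  have h1 := h 1
  refine contDiff_euclidean.2 fun i => ?_
  fin_cases i
  · simp only [field, Fin.zero_eta, Matrix.cons_val_zero]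
    fun_prop
  · simp only [field, Fin.mk_one, Matrix.cons_val_one, Matrix.cons_val_fin_one]
    fun_prop

/-- A maximal solution agrees with any global forward solution with the same initial value. -/
theorem IsMaximalSolution.forward {v : EuclideanSpace ℝ (Fin 2) → EuclideanSpace ℝ (Fin 2)}
    (hv : ContDiff ℝ 2 v) {J : Set ℝ} {γ η : ℝ → EuclideanSpace ℝ (Fin 2)} {t₀ : ℝ}
    (h : IsMaximalSolution v J γ) (ht₀ : t₀ ∈ J)
    (hη : ∀ t, t₀ ≤ t → HasDerivAt η (v (η t)) t) (h0 : γ t₀ = η t₀) :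
    Ici t₀ ⊆ J ∧ EqOn γ η (Ici t₀) := by
  obtain ⟨⟨hJo, hJc, hJd⟩, hmax⟩ := h
  have hunique : ∀ T ∈ J, t₀ ≤ T → γ T = η T := by
    -- On `[t₀, T]` both trajectories stay in one closed ball, and `v` is Lipschitz there.
    intro T hT hle
    have hsub : Icc t₀ T ⊆ J := hJc.out ht₀ hT
    have hγc : ContinuousOn γ (Icc t₀ T) := fun t ht =>
      (hJd t (hsub ht)).continuousAt.continuousWithinAt
    have hηc : ContinuousOn η (Icc t₀ T) := fun t ht =>
      (hη t ht.1).continuousAt.continuousWithinAt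
    obtain ⟨R, hR⟩ := ((isCompact_Icc.image_of_continuousOn hγc).union
      (isCompact_Icc.image_of_continuousOn hηc)).isBounded.subset_closedBall 0
    obtain ⟨K, hK⟩ := (hv.contDiffOn (s := Metric.closedBall 0 R)).exists_lipschitzOnWith
      two_ne_zero (convex_closedBall 0 R) (isCompact_closedBall 0 R)
    have hss : Ico t₀ T ⊆ Icc t₀ T := Ico_subset_Icc_self
    exact ODE_solution_unique_of_mem_Icc_right (v := fun _ => v)
      (s := fun _ => Metric.closedBall 0 R) (fun _ _ => hK) hγc
      (fun t ht => (hJd t (hsub (hss ht))).hasDerivWithinAt)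
      (fun t ht => hR (Or.inl (mem_image_of_mem _ (hss ht)))) hηc
      (fun t ht => (hη t ht.1).hasDerivWithinAt)
      (fun t ht => hR (Or.inr (mem_image_of_mem _ (hss ht)))) h0 ⟨hle, le_rfl⟩
  have hglue : Ici t₀ ⊆ J := by
    -- Following `γ` up to `t₀` and `η` afterwards extends `γ`, so maximality forces `J` to contain
    -- all later times.
    let γ' : ℝ → EuclideanSpace ℝ (Fin 2) := fun t => if t ≤ t₀ then γ t else η t
    have hJ' : J ∪ Ici t₀ = J ∪ Ioi t₀ := by
      ext t
      simp only [mem_union, mem_Ici, mem_Ioi]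
      constructor
      · rintro (h | h)
        · exact Or.inl h
        · rcases h.eq_or_lt with rfl | h
          · exact Or.inl ht₀
          · exact Or.inr h
      · exact Or.imp_right le_of_lt
    have heq : EqOn γ' γ J := fun t ht => by
      by_cases h : t ≤ t₀
      · simp [γ', h]
      · simp [γ', h, hunique t ht (not_le.1 h).le]
    refine subset_union_right.trans (hmax (J ∪ Ici t₀) γ' ⟨?_, ?_, ?_⟩ subset_union_left heq)
    · rw [hJ']; exact hJo.union isOpen_Ioi
    · refine ⟨fun x hx y hy z hz => ?_⟩
      rcases le_or_gt t₀ z with h | h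
      · exact Or.inr h
      · refine Or.inl (hJc.out (hx.resolve_right ?_) ht₀ ⟨hz.1, h.le⟩)
        exact not_le.2 (hz.1.trans_lt h)
    · rw [hJ']
      rintro t (ht | ht)
      · have := (hJd t ht).congr_of_eventuallyEq (f₁ := γ')
          (heq.eventuallyEq_of_mem (hJo.mem_nhds ht))
        rwa [heq ht]
      · have hev : γ' =ᶠ[𝓝 t] η := by
          filter_upwards [isOpen_Ioi.mem_nhds ht] with s hs
          simp [γ', not_le.2 (mem_Ioi.1 hs)]
        rw [hev.eq_of_nhds]
        exact (hη t (le_of_lt ht)).congr_of_eventuallyEq hev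
  exact ⟨hglue, fun t ht => hunique t (hglue ht) ht⟩

/-- A curve tangent to a vector field, with bounded rate `q`, can be reparametrized to a
solution defined for all future times. -/
theorem exists_time_change {v : EuclideanSpace ℝ (Fin 2) → EuclideanSpace ℝ (Fin 2)}
    {c : ℝ → EuclideanSpace ℝ (Fin 2)} {q : ℝ → ℝ} {φ₀ Q : ℝ}
    (hc : ∀ φ, φ₀ ≤ φ → HasDerivAt c ((q φ)⁻¹ • v (c φ)) φ)
    (hqc : ContinuousOn q (Ici φ₀)) (hq : ∀ φ, φ₀ ≤ φ → 0 < q φ ∧ q φ ≤ Q) (t₀ : ℝ) :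
    ∃ θ : ℝ → ℝ, θ t₀ = φ₀ ∧ θ '' Ici t₀ = Ici φ₀ ∧
      ∀ t, t₀ ≤ t → HasDerivAt (c ∘ θ) (v ((c ∘ θ) t)) t := by
  -- The inverse rate is frozen to the left of `φ₀`, so that the time `τ` is defined on the whole
  -- line. Its slope is at least `1 / Q`, which makes it an increasing bijection and excludes
  -- running through the entire curve in finite time.
  let r : ℝ → ℝ := fun φ => (q (max φ φ₀))⁻¹
  have hrc : Continuous r := by
    refine Continuous.inv₀ ?_ fun φ => (hq _ (le_max_right _ _)).1.ne'
    exact hqc.comp_continuous (by fun_prop) fun φ => le_max_right φ φ₀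
  have hQ : 0 < Q := (hq φ₀ le_rfl).1.trans_le (hq φ₀ le_rfl).2
  have hr : ∀ φ, Q⁻¹ ≤ r φ := fun φ =>
    inv_anti₀ (hq _ (le_max_right _ _)).1 (hq _ (le_max_right _ _)).2
  have hQi : 0 < Q⁻¹ := inv_pos.2 hQ
  let τ : ℝ → ℝ := fun φ => t₀ + ∫ x in φ₀..φ, r x
  have hτd : ∀ φ, HasDerivAt τ (r φ) φ := fun φ =>
    (intervalIntegral.integral_hasDerivAt_right hrc.continuousOn.intervalIntegrable
      hrc.aestronglyMeasurable.stronglyMeasurableAtFilter hrc.continuousAt).const_add t₀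
  have hdiff : ∀ a b, a ≤ b → Q⁻¹ * (b - a) ≤ τ b - τ a := by
    intro a b hab
    have hd : ∀ φ, HasDerivAt (fun φ => τ φ - Q⁻¹ * φ) (r φ - Q⁻¹ * 1) φ := fun φ =>
      (hτd φ).sub ((hasDerivAt_id φ).const_mul Q⁻¹)
    have hm : Monotone fun φ => τ φ - Q⁻¹ * φ := by
      refine monotone_of_deriv_nonneg (fun φ => (hd φ).differentiableAt) fun φ => ?_
      rw [(hd φ).deriv]
      have := hr φ
      linarith
    have := hm hab
    simp only at this
    linarith
  have hmono : StrictMono τ := fun a b hab => by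
    have := hdiff a b hab.le
    have := mul_pos hQi (sub_pos.2 hab)
    linarith
  have hτc : Continuous τ := continuous_iff_continuousAt.2 fun φ => (hτd φ).continuousAt
  have hτ0 : τ φ₀ = t₀ := by simp [τ]
  have hsurj : Function.Surjective τ := by
    refine hτc.surjective ?_ ?_
    · refine tendsto_atTop_mono' _ ?_ (tendsto_atTop_add_const_left atTop (τ φ₀ - Q⁻¹ * φ₀)
        (tendsto_id.const_mul_atTop hQi))
      filter_upwards [eventually_ge_atTop φ₀] with φ hφ
      have := hdiff _ _ hφ
      simp only [id]
      linarith
    · refine tendsto_atBot_mono' _ ?_ (tendsto_atBot_add_const_left atBot (τ φ₀ - Q⁻¹ * φ₀)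
        (tendsto_id.const_mul_atBot hQi))
      filter_upwards [eventually_le_atBot φ₀] with φ hφ
      have := hdiff _ _ hφ
      simp only [id]
      linarith
  let e : ℝ ≃o ℝ := hmono.orderIsoOfSurjective τ hsurj
  have he : ∀ φ, e φ = τ φ := fun φ => rfl
  have hes : ∀ t, τ (e.symm t) = t := fun t => by rw [← he, e.apply_symm_apply]
  have hse : ∀ φ, e.symm (τ φ) = φ := fun φ => by rw [← he, e.symm_apply_apply]
  have h0 : e.symm t₀ = φ₀ := by rw [← hτ0, hse]
  have hge : ∀ t, t₀ ≤ t → φ₀ ≤ e.symm t := fun t ht => by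
    rw [← h0]; exact e.symm.monotone ht
  refine ⟨e.symm, h0, ?_, fun t ht => ?_⟩
  · ext φ
    constructor
    · rintro ⟨t, ht, rfl⟩
      exact hge t ht
    · intro hφ
      refine ⟨τ φ, ?_, hse φ⟩
      rw [mem_Ici, ← hτ0]
      exact hmono.monotone hφ
  · have hq0 := (hq _ (hge t ht)).1
    have hrt : r (e.symm t) = (q (e.symm t))⁻¹ := by simp only [r, max_eq_left (hge t ht)]
    have h1 : HasDerivAt e.symm (r (e.symm t))⁻¹ t :=
      HasDerivAt.of_local_left_inverse e.symm.continuous.continuousAt (hτd _)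
        (by rw [hrt]; exact (inv_pos.2 hq0).ne') (Eventually.of_forall hes)
    rw [hrt, inv_inv] at h1
    have h2 := (hc _ (hge t ht)).scomp t h1
    rwa [smul_smul, mul_inv_cancel₀ hq0.ne', one_smul] at h2

/-! ### Polar coordinates in the plane -/

theorem polarPoint_zero (r φ : ℝ) : polarPoint r φ 0 = r * Real.cos φ := rfl

theorem polarPoint_one (r φ : ℝ) : polarPoint r φ 1 = r * Real.sin φ := rfl

theorem norm_sq_plane (p : EuclideanSpace ℝ (Fin 2)) : ‖p‖ ^ 2 = p 0 ^ 2 + p 1 ^ 2 := by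
  rw [EuclideanSpace.norm_sq_eq]
  simp [Fin.sum_univ_two, sq_abs]

theorem norm_polarPoint {r : ℝ} (hr : 0 ≤ r) (φ : ℝ) : ‖polarPoint r φ‖ = r := by
  refine (pow_left_inj₀ (norm_nonneg _) hr two_ne_zero).1 ?_
  rw [norm_sq_plane, polarPoint_zero, polarPoint_one]
  linear_combination r ^ 2 * Real.cos_sq_add_sin_sq φ

theorem exists_polarPoint_eq (p : EuclideanSpace ℝ (Fin 2)) : ∃ φ, p = polarPoint ‖p‖ φ := by
  rcases eq_or_ne p 0 with rfl | hp
  · refine ⟨0, ?_⟩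
    ext i; fin_cases i <;> simp [polarPoint]
  have hn : ‖p‖ = ‖(⟨p 0, p 1⟩ : ℂ)‖ := by
    refine (pow_left_inj₀ (norm_nonneg _) (norm_nonneg _) two_ne_zero).1 ?_
    rw [norm_sq_plane, Complex.sq_norm, Complex.normSq_mk]
    ring
  refine ⟨Complex.arg ⟨p 0, p 1⟩, ?_⟩
  ext i
  fin_cases i
  · simp [polarPoint_zero, hn, Complex.norm_mul_cos_arg]
  · simp [polarPoint_one, hn, Complex.norm_mul_sin_arg]

theorem hasDerivAt_plane {x y : ℝ → ℝ} {x' y' t : ℝ} (hx : HasDerivAt x x' t)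
    (hy : HasDerivAt y y' t) :
    HasDerivAt (fun t => (!₂[x t, y t] : EuclideanSpace ℝ (Fin 2))) !₂[x', y'] t := by
  rw [hasDerivAt_iff_hasFDerivAt, ← hasFDerivWithinAt_univ, hasFDerivWithinAt_euclidean]
  intro i
  rw [hasFDerivWithinAt_univ]
  fin_cases i
  · refine hx.hasFDerivAt.congr_fderiv ?_
    ext; simp
  · refine hy.hasFDerivAt.congr_fderiv ?_
    ext; simp

theorem hasDerivAt_polarPoint {f : ℝ → ℝ} {f' φ : ℝ} (hf : HasDerivAt f f' φ) :
    HasDerivAt (fun φ => polarPoint (f φ) φ)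
      !₂[f' * Real.cos φ - f φ * Real.sin φ, f' * Real.sin φ + f φ * Real.cos φ] φ := by
  refine hasDerivAt_plane ?_ (hf.mul (Real.hasDerivAt_sin φ))
  refine (hf.mul (Real.hasDerivAt_cos φ)).congr_deriv ?_
  ring

/-! ### Explicit spiral trajectories -/

/-- `G` is the first integral `x^(2n) + y^(2n)` along a trajectory of the stable focus, as a
function of the generalized angle. -/
structure IsRadialProfile (k : ℕ) (G : ℝ → ℝ) : Prop where
  pos : ∀ u, 0 ≤ u → 0 < G u
  hasDerivAt : ∀ u, 0 ≤ u → HasDerivAt G (-2 * G u ^ (k + 1)) u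
  tendsto : Tendsto G atTop (𝓝 0)

theorem IsRadialProfile.strictAntiOn {k : ℕ} {G : ℝ → ℝ} (hG : IsRadialProfile k G) :
    StrictAntiOn G (Ici 0) := by
  refine strictAntiOn_of_deriv_neg (convex_Ici 0)
    (fun u hu => (hG.hasDerivAt u hu).continuousAt.continuousWithinAt) fun u hu => ?_
  rw [interior_Ici] at hu
  rw [(hG.hasDerivAt u (le_of_lt hu)).deriv]
  have := pow_pos (hG.pos u (le_of_lt hu)) (k + 1)
  linarith

theorem isRadialProfile_exp {H : ℝ} (hH : 0 < H) :
    IsRadialProfile 0 fun u => H * Real.exp (-2 * u) := by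
  refine ⟨fun u _ => by positivity, fun u _ => ?_, ?_⟩
  · refine ((((hasDerivAt_id u).const_mul (-2)).exp).const_mul H).congr_deriv ?_
    simp only [id]; ring
  · have : Tendsto (fun u : ℝ => -2 * u) atTop atBot :=
      tendsto_id.const_mul_atTop_of_neg (by norm_num)
    simpa using (Real.tendsto_exp_atBot.comp this).const_mul H

/-- The equation is of Bernoulli type: `G^(-k)` has constant derivative `2k`, hence is affine in
`u`. -/
theorem isRadialProfile_rpow {k : ℕ} (hk : 0 < k) {a : ℝ} (ha : 0 < a) :
    IsRadialProfile k fun u => (a + 2 * k * u) ^ (-(k : ℝ)⁻¹) := by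
  have hk0 : (0 : ℝ) < k := by exact_mod_cast hk
  refine ⟨fun u hu => by positivity, fun u hu => ?_, ?_⟩
  · have hb : 0 < a + 2 * k * u := by positivity
    have h1 : HasDerivAt (fun u => a + 2 * k * u) (2 * k * 1) u :=
      ((hasDerivAt_id u).const_mul (2 * (k : ℝ))).const_add a
    refine (h1.rpow_const (p := -(k : ℝ)⁻¹) (Or.inl hb.ne')).congr_deriv ?_
    rw [pow_succ, ← Real.rpow_natCast, ← Real.rpow_mul hb.le, Real.rpow_sub hb, Real.rpow_one,
      show -(k : ℝ)⁻¹ * k = -1 by field_simp, Real.rpow_neg_one]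
    field_simp
  · refine (tendsto_rpow_neg_atTop (inv_pos.2 hk0)).comp ?_
    exact tendsto_atTop_add_const_left _ _ (tendsto_id.const_mul_atTop (by positivity))

/-- The radius, as a function of the polar angle, of the trajectory with radial profile `G`. -/
noncomputable def spiralRadius (n : ℕ) (G : ℝ → ℝ) (φ₀ φ : ℝ) : ℝ :=
  (G (generalizedAngle n φ₀ φ) / angularNorm n φ) ^ (((2 * n : ℕ) : ℝ)⁻¹)

/-- The logarithmic derivative of `spiralRadius`. -/
noncomputable def radialRate (n k : ℕ) (G : ℝ → ℝ) (φ₀ φ : ℝ) : ℝ :=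
  (Real.cos φ ^ (2 * n - 1) * Real.sin φ - Real.sin φ ^ (2 * n - 1) * Real.cos φ
    - (Real.cos φ * Real.sin φ) ^ (n - 1) * G (generalizedAngle n φ₀ φ) ^ k) / angularNorm n φ

/-- The trajectory with radial profile `G`, parametrized by the polar angle. -/
noncomputable def spiralCurve (n : ℕ) (G : ℝ → ℝ) (φ₀ φ : ℝ) : EuclideanSpace ℝ (Fin 2) :=
  polarPoint (spiralRadius n G φ₀ φ) φ

section Spiral

variable {n k : ℕ} {G : ℝ → ℝ} {φ₀ φ : ℝ}

theorem quotient_pos (hn : Odd n) (hG : IsRadialProfile k G) (hφ : φ₀ ≤ φ) :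
    0 < G (generalizedAngle n φ₀ φ) / angularNorm n φ :=
  div_pos (hG.pos _ (generalizedAngle_nonneg hn hφ)) (angularNorm_pos n φ)

theorem spiralRadius_pos (hn : Odd n) (hG : IsRadialProfile k G) (hφ : φ₀ ≤ φ) :
    0 < spiralRadius n G φ₀ φ :=
  Real.rpow_pos_of_pos (quotient_pos hn hG hφ) _

theorem spiralRadius_pow (hn : Odd n) (hG : IsRadialProfile k G) (hφ : φ₀ ≤ φ) :
    spiralRadius n G φ₀ φ ^ (2 * n) * angularNorm n φ = G (generalizedAngle n φ₀ φ) := by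
  rw [spiralRadius, Real.rpow_inv_natCast_pow (quotient_pos hn hG hφ).le
    (by have := hn.pos; omega), div_mul_cancel₀ _ (angularNorm_pos n φ).ne']

theorem spiralRadius_initial (hn : Odd n) {r : ℝ} (hr : 0 ≤ r)
    (h0 : G 0 = r ^ (2 * n) * angularNorm n φ₀) : spiralRadius n G φ₀ φ₀ = r := by
  rw [spiralRadius, generalizedAngle_self, h0, mul_div_cancel_right₀ _ (angularNorm_pos n φ₀).ne',
    Real.pow_rpow_inv_natCast hr (by have := hn.pos; omega)]

/-- Logarithmic differentiation of `r^(2n) * angularNorm = G`, where `G' / G = -2 G^k`. -/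
theorem hasDerivAt_spiralRadius (hn : Odd n) (hG : IsRadialProfile k G) (hφ : φ₀ ≤ φ) :
    HasDerivAt (spiralRadius n G φ₀) (spiralRadius n G φ₀ φ * radialRate n k G φ₀ φ) φ := by
  have hq := quotient_pos hn hG hφ
  have hh := angularNorm_pos n φ
  have hn0 : (n : ℝ) ≠ 0 := by exact_mod_cast hn.pos.ne'
  have h1 := (hG.hasDerivAt _ (generalizedAngle_nonneg hn hφ)).comp φ
    (hasDerivAt_generalizedAngle n φ₀ φ)
  have h2 := (h1.div (hasDerivAt_angularNorm n φ) hh.ne').rpow_const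
    (p := ((2 * n : ℕ) : ℝ)⁻¹) (Or.inl hq.ne')
  refine h2.congr_deriv ?_
  have hg := hG.pos _ (generalizedAngle_nonneg hn hφ)
  rw [Pi.div_apply, Function.comp_apply, Real.rpow_sub hq, Real.rpow_one, spiralRadius, radialRate,
    angularSpeed]
  set g := G (generalizedAngle n φ₀ φ)
  set P := (g / angularNorm n φ) ^ (((2 * n : ℕ) : ℝ)⁻¹)
  push_cast
  field_simp
  ring

theorem continuousOn_spiralRadius (hn : Odd n) (hG : IsRadialProfile k G) :
    ContinuousOn (spiralRadius n G φ₀) (Ici φ₀) := fun _ hφ =>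
  (hasDerivAt_spiralRadius hn hG hφ).continuousAt.continuousWithinAt

theorem spiralRadius_le (hn : Odd n) (hG : IsRadialProfile k G) (hφ : φ₀ ≤ φ) :
    spiralRadius n G φ₀ φ ≤
      (2 ^ n * G (generalizedAngle n φ₀ φ)) ^ (((2 * n : ℕ) : ℝ)⁻¹) := by
  refine Real.rpow_le_rpow (quotient_pos hn hG hφ).le ?_ (by positivity)
  rw [div_le_iff₀ (angularNorm_pos n φ)]
  have hg := hG.pos _ (generalizedAngle_nonneg hn hφ)
  have h2 : (2 : ℝ) ^ n * (1 / 2) ^ n = 1 := by rw [← mul_pow]; norm_num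
  have := angularNorm_ge n φ
  calc G (generalizedAngle n φ₀ φ) = 2 ^ n * G (generalizedAngle n φ₀ φ) * (1 / 2) ^ n := by
        linear_combination -G (generalizedAngle n φ₀ φ) * h2
    _ ≤ _ := by gcongr

theorem le_spiralRadius (hn : Odd n) (hG : IsRadialProfile k G) (hφ : φ₀ ≤ φ) :
    (G (generalizedAngle n φ₀ φ) / 2) ^ (((2 * n : ℕ) : ℝ)⁻¹) ≤ spiralRadius n G φ₀ φ := by
  have hg := hG.pos _ (generalizedAngle_nonneg hn hφ)
  refine Real.rpow_le_rpow (by positivity) ?_ (by positivity)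
  have := angularNorm_le n φ
  have := angularNorm_pos n φ
  gcongr

theorem profile_le (hn : Odd n) (hG : IsRadialProfile k G) (hφ : φ₀ ≤ φ) :
    G (generalizedAngle n φ₀ φ) ≤ G 0 :=
  hG.strictAntiOn.antitoneOn self_mem_Ici (generalizedAngle_nonneg hn hφ)
    (generalizedAngle_nonneg hn hφ)

theorem exists_spiralRadius_bound (hn : Odd n) (hG : IsRadialProfile k G) (φ₀ : ℝ) :
    ∃ R, 0 < R ∧ ∀ φ, φ₀ ≤ φ → spiralRadius n G φ₀ φ ≤ R := by
  have hg := hG.pos 0 le_rfl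
  refine ⟨(2 ^ n * G 0) ^ (((2 * n : ℕ) : ℝ)⁻¹), by positivity, fun φ hφ => ?_⟩
  have := hG.pos _ (generalizedAngle_nonneg hn hφ)
  have := profile_le hn hG hφ
  exact (spiralRadius_le hn hG hφ).trans (by gcongr)

theorem exists_radialRate_bound (hn : Odd n) (hG : IsRadialProfile k G) (φ₀ : ℝ) :
    ∃ L, 0 < L ∧ ∀ φ, φ₀ ≤ φ → |radialRate n k G φ₀ φ| ≤ L := by
  have hg := hG.pos 0 le_rfl
  -- The numerator of the rate is at most `2 + G 0 ^ k` in absolute value, and the denominator is at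
  -- least `2^(-n)`.
  refine ⟨2 ^ n * (2 + G 0 ^ k), by positivity, fun φ hφ => ?_⟩
  have hh := angularNorm_pos n φ
  have hgφ := hG.pos _ (generalizedAngle_nonneg hn hφ)
  have hgle := profile_le hn hG hφ
  have hc := Real.abs_cos_le_one φ
  have hs := Real.abs_sin_le_one φ
  rw [radialRate, abs_div, abs_of_pos hh, div_le_iff₀ hh]
  have h2 : (2 : ℝ) ^ n * (1 / 2) ^ n = 1 := by rw [← mul_pow]; norm_num
  have h3 := angularNorm_ge n φ
  have e1 : |Real.cos φ ^ (2 * n - 1) * Real.sin φ| ≤ 1 := by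
    rw [abs_mul, abs_pow]
    exact mul_le_one₀ (pow_le_one₀ (abs_nonneg _) hc) (abs_nonneg _) hs
  have e2 : |Real.sin φ ^ (2 * n - 1) * Real.cos φ| ≤ 1 := by
    rw [abs_mul, abs_pow]
    exact mul_le_one₀ (pow_le_one₀ (abs_nonneg _) hs) (abs_nonneg _) hc
  have e3 : |(Real.cos φ * Real.sin φ) ^ (n - 1) * G (generalizedAngle n φ₀ φ) ^ k| ≤ G 0 ^ k := by
    rw [abs_mul, abs_pow, abs_mul, abs_of_pos (pow_pos hgφ k)]
    calc _ ≤ 1 * G (generalizedAngle n φ₀ φ) ^ k := by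
          gcongr
          exact pow_le_one₀ (by positivity) (mul_le_one₀ hc (abs_nonneg _) hs)
      _ ≤ _ := by rw [one_mul]; gcongr
  calc _ ≤ 2 + G 0 ^ k := by
        refine (abs_sub _ _).trans (add_le_add ((abs_sub _ _).trans ?_) e3)
        linarith
    _ = 2 ^ n * (2 + G 0 ^ k) * (1 / 2) ^ n := by linear_combination -(2 + G 0 ^ k) * h2
    _ ≤ _ := by gcongr

/-- A full turn leaves the angular factor unchanged and advances the generalized angle by `2π`,
along which `G` strictly decreases. -/
theorem spiralRadius_add_two_pi_lt (hn : Odd n) (hG : IsRadialProfile k G) (hφ : φ₀ ≤ φ) :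
    spiralRadius n G φ₀ (φ + 2 * Real.pi) < spiralRadius n G φ₀ φ := by
  have hw := generalizedAngle_nonneg hn hφ
  have hpi := Real.pi_pos
  have hh := angularNorm_pos n φ
  have hn0 : (0 : ℝ) < ((2 * n : ℕ) : ℝ) := by
    have := hn.pos
    exact_mod_cast (by omega : 0 < 2 * n)
  rw [spiralRadius, spiralRadius, angularNorm_add_two_pi, generalizedAngle_add_two_pi hn]
  have hlt := hG.strictAntiOn (mem_Ici.2 hw)
    (mem_Ici.2 (show 0 ≤ generalizedAngle n φ₀ φ + 2 * Real.pi by linarith)) (by linarith)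
  have := hG.pos (generalizedAngle n φ₀ φ + 2 * Real.pi) (by linarith)
  refine Real.rpow_lt_rpow (by positivity) ?_ (by positivity)
  gcongr

theorem spiralRadius_add_nat_mul_lt (hn : Odd n) (hG : IsRadialProfile k G) (hφ : φ₀ ≤ φ)
    (m : ℕ) : spiralRadius n G φ₀ (φ + (m + 1 : ℕ) * (2 * Real.pi)) < spiralRadius n G φ₀ φ := by
  induction m with
  | zero => simpa using spiralRadius_add_two_pi_lt hn hG hφ
  | succ m ih =>
    refine lt_trans ?_ ih
    have := Real.pi_pos
    have hle : φ₀ ≤ φ + (m + 1 : ℕ) * (2 * Real.pi) := by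
      have : 0 ≤ ((m + 1 : ℕ) : ℝ) * (2 * Real.pi) := by positivity
      linarith
    refine lt_of_eq_of_lt ?_ (spiralRadius_add_two_pi_lt hn hG hle)
    congr 1; push_cast; ring

theorem tendsto_spiralRadius (hn : Odd n) (hG : IsRadialProfile k G) (φ₀ : ℝ) :
    Tendsto (spiralRadius n G φ₀) atTop (𝓝 0) := by
  have hn0 : (0 : ℝ) < ((2 * n : ℕ) : ℝ) := by
    have := hn.pos
    exact_mod_cast (by omega : 0 < 2 * n)
  have h1 := ((hG.tendsto.comp (tendsto_generalizedAngle hn φ₀)).const_mul (2 ^ n)).rpow_const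
    (p := ((2 * n : ℕ) : ℝ)⁻¹) (Or.inr (by positivity))
  rw [mul_zero, Real.zero_rpow (by positivity)] at h1
  refine tendsto_of_tendsto_of_tendsto_of_le_of_le' tendsto_const_nhds h1 ?_ ?_
  · filter_upwards [eventually_ge_atTop φ₀] with φ hφ using (spiralRadius_pos hn hG hφ).le
  · filter_upwards [eventually_ge_atTop φ₀] with φ hφ using spiralRadius_le hn hG hφ

theorem isPosFocusSpiral_spiralCurve (hn : Odd n) (hG : IsRadialProfile k G) (φ₀ : ℝ) :
    IsPosFocusSpiral (spiralCurve n G φ₀ '' Ici φ₀) φ₀ (spiralRadius n G φ₀) where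
  continuousOn := continuousOn_spiralRadius hn hG
  pos _ hφ := spiralRadius_pos hn hG hφ
  decreasing _ hφ := spiralRadius_add_two_pi_lt hn hG hφ
  tendsto := tendsto_spiralRadius hn hG φ₀
  eq_image := rfl

theorem hasDerivAt_spiralCurve (hn : Odd n) (hG : IsRadialProfile k G) (hφ : φ₀ ≤ φ) :
    HasDerivAt (spiralCurve n G φ₀)
      (spiralRadius n G φ₀ φ • !₂[radialRate n k G φ₀ φ * Real.cos φ - Real.sin φ,
        radialRate n k G φ₀ φ * Real.sin φ + Real.cos φ]) φ := by
  refine (hasDerivAt_polarPoint (hasDerivAt_spiralRadius hn hG hφ)).congr_deriv ?_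
  ext i
  fin_cases i <;> simp <;> ring

/-- The angular velocity of the flow along a trajectory. -/
noncomputable def angularVelocity (n : ℕ) (G : ℝ → ℝ) (φ₀ φ : ℝ) : ℝ :=
  n * spiralRadius n G φ₀ φ ^ (2 * n - 2) * angularNorm n φ

/-- The field is tangent to the explicit curve: the perturbation being radial, the angular velocity
is `n H / r^2`, and the radial component is then the one prescribed by `radialRate`. -/
theorem field_spiralCurve (hn : Odd n) (hG : IsRadialProfile k G) (hφ : φ₀ ≤ φ) :
    field n k (-1) (spiralCurve n G φ₀ φ) = angularVelocity n G φ₀ φ •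
      spiralRadius n G φ₀ φ • !₂[radialRate n k G φ₀ φ * Real.cos φ - Real.sin φ,
        radialRate n k G φ₀ φ * Real.sin φ + Real.cos φ] := by
  have hh := angularNorm_pos n φ
  have hpow := spiralRadius_pow hn hG hφ
  have hrate : radialRate n k G φ₀ φ * angularNorm n φ = Real.cos φ ^ (2 * n - 1) * Real.sin φ -
      Real.sin φ ^ (2 * n - 1) * Real.cos φ
      - (Real.cos φ * Real.sin φ) ^ (n - 1) * G (generalizedAngle n φ₀ φ) ^ k := by
    rw [radialRate, div_mul_cancel₀ _ hh.ne']
  have hH : (spiralRadius n G φ₀ φ * Real.cos φ) ^ (2 * n) +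
      (spiralRadius n G φ₀ φ * Real.sin φ) ^ (2 * n) = G (generalizedAngle n φ₀ φ) := by
    rw [← hpow, angularNorm]; ring
  have hN : angularNorm n φ = Real.cos φ ^ (2 * n) + Real.sin φ ^ (2 * n) := rfl
  have hcs := Real.cos_sq_add_sin_sq φ
  have hx : spiralCurve n G φ₀ φ 0 = spiralRadius n G φ₀ φ * Real.cos φ := rfl
  have hy : spiralCurve n G φ₀ φ 1 = spiralRadius n G φ₀ φ * Real.sin φ := rfl
  rw [angularVelocity]
  simp only [field, hx, hy, hH]
  generalize G (generalizedAngle n φ₀ φ) ^ k = K at hrate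
  generalize spiralRadius n G φ₀ φ = r
  generalize radialRate n k G φ₀ φ = ℓ at hrate
  generalize angularNorm n φ = h at hrate hN
  generalize Real.cos φ = c at *
  generalize Real.sin φ = s at *
  obtain ⟨m, rfl⟩ := hn
  have e1 : 2 * (2 * m + 1) - 1 = 4 * m + 1 := by omega
  have e2 : 2 * (2 * m + 1) - 2 = 4 * m := by omega
  have e3 : 2 * m + 1 - 1 = 2 * m := rfl
  have e4 : 2 * (2 * m + 1) = 4 * m + 2 := by ring
  rw [e1, e3] at hrate
  rw [e4] at hN
  rw [e1, e2, e3]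
  ext i
  fin_cases i
  · simp
    linear_combination -((2 * m + 1) * r ^ (4 * m + 1) * c) * hrate +
      (2 * m + 1) * r ^ (4 * m + 1) * s * hN + (2 * m + 1) * r ^ (4 * m + 1) * s ^ (4 * m + 1) * hcs
  · simp
    linear_combination -((2 * m + 1) * r ^ (4 * m + 1) * s) * hrate -
      (2 * m + 1) * r ^ (4 * m + 1) * c * hN - (2 * m + 1) * r ^ (4 * m + 1) * c ^ (4 * m + 1) * hcs

/-- The forward trajectory through the point with polar angle `φ₀` is the explicit spiral. -/
theorem forward_trajectory (hn : Odd n) (hG : IsRadialProfile k G) {J : Set ℝ}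
    {γ : ℝ → EuclideanSpace ℝ (Fin 2)} {t₀ : ℝ} (h : IsMaximalSolution (field n k (-1)) J γ)
    (ht₀ : t₀ ∈ J) (h0 : γ t₀ = spiralCurve n G φ₀ φ₀) :
    Ici t₀ ⊆ J ∧ γ '' Ici t₀ = spiralCurve n G φ₀ '' Ici φ₀ := by
  have hnpos : (0 : ℝ) < n := by exact_mod_cast hn.pos
  have hvpos : ∀ φ, φ₀ ≤ φ → 0 < angularVelocity n G φ₀ φ := fun φ hφ => by
    have := spiralRadius_pos hn hG hφ
    have := angularNorm_pos n φ
    unfold angularVelocity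
    positivity
  obtain ⟨R, hR, hRle⟩ := exists_spiralRadius_bound hn hG φ₀
  obtain ⟨θ, hθ0, hθi, hθd⟩ := exists_time_change (v := field n k (-1))
    (c := spiralCurve n G φ₀) (q := angularVelocity n G φ₀) (φ₀ := φ₀)
    (Q := n * R ^ (2 * n - 2) * 2) (fun φ hφ => by
      rw [field_spiralCurve hn hG hφ, inv_smul_smul₀ (hvpos φ hφ).ne']
      exact hasDerivAt_spiralCurve hn hG hφ)
    ((continuousOn_const.mul ((continuousOn_spiralRadius hn hG).pow _)).mul
      (continuous_angularNorm n).continuousOn) (fun φ hφ => ⟨hvpos φ hφ, by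
      have := spiralRadius_pos hn hG hφ
      have := hRle φ hφ
      have := angularNorm_pos n φ
      have := angularNorm_le n φ
      unfold angularVelocity
      gcongr⟩) t₀
  obtain ⟨h1, h2⟩ := h.forward (contDiff_field n k (-1)) ht₀ hθd
    (by rw [h0, Function.comp_apply, hθ0])
  refine ⟨h1, ?_⟩
  rw [h2.image_eq, image_comp, hθi]

/-- Coinciding points have equal radii and angles differing by a multiple of `2π`. A nonzero
multiple would contradict the decrease of the radius from turn to turn. -/
theorem injOn_spiralCurve (hn : Odd n) (hG : IsRadialProfile k G) (φ₀ : ℝ) :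
    InjOn (spiralCurve n G φ₀) (Ici φ₀) := by
  have key : ∀ a b, φ₀ ≤ a → a < b → spiralCurve n G φ₀ a ≠ spiralCurve n G φ₀ b := by
    intro a b ha hab heq
    have hra := spiralRadius_pos hn hG ha
    have hrb := spiralRadius_pos hn hG (ha.trans hab.le)
    have hr : spiralRadius n G φ₀ a = spiralRadius n G φ₀ b := by
      rw [← norm_polarPoint hra.le a, ← norm_polarPoint hrb.le b]
      exact congrArg _ heq
    have hc : Real.cos b = Real.cos a := by
      have : spiralCurve n G φ₀ a 0 = spiralCurve n G φ₀ b 0 := by rw [heq]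
      simp only [spiralCurve, polarPoint_zero, hr] at this
      exact (mul_left_cancel₀ hrb.ne' this).symm
    have hs : Real.sin b = Real.sin a := by
      have : spiralCurve n G φ₀ a 1 = spiralCurve n G φ₀ b 1 := by rw [heq]
      simp only [spiralCurve, polarPoint_one, hr] at this
      exact (mul_left_cancel₀ hrb.ne' this).symm
    obtain ⟨m, hm⟩ := Real.Angle.angle_eq_iff_two_pi_dvd_sub.1 (Real.Angle.cos_sin_inj hc hs)
    have hpi := Real.pi_pos
    have hm0 : (0 : ℝ) < m := by
      by_contra! hneg
      nlinarith
    have hm1 : 0 < m := by exact_mod_cast hm0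
    obtain ⟨j, rfl⟩ : ∃ j : ℕ, m = (j + 1 : ℕ) := ⟨(m - 1).toNat, by omega⟩
    have := spiralRadius_add_nat_mul_lt hn hG ha j
    have hb : b = a + (j + 1 : ℕ) * (2 * Real.pi) := by
      push_cast at hm ⊢
      linarith
    rw [← hb, hr] at this
    exact lt_irrefl _ this
  intro a ha b hb heq
  rcases lt_trichotomy a b with h | h | h
  · exact absurd heq (key a b ha h)
  · exact h
  · exact absurd heq.symm (key b a hb h)

theorem isBounded_spiralCurve (hn : Odd n) (hG : IsRadialProfile k G) (φ₀ : ℝ) :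
    Bornology.IsBounded (spiralCurve n G φ₀ '' Ici φ₀) := by
  obtain ⟨R, -, hR⟩ := exists_spiralRadius_bound hn hG φ₀
  refine isBounded_iff_forall_norm_le.2 ⟨R, ?_⟩
  rintro _ ⟨φ, hφ, rfl⟩
  rw [spiralCurve, norm_polarPoint (spiralRadius_pos hn hG hφ).le]
  exact hR φ hφ

end Spiral

/-! ### Comparison with exponential and power spirals -/

/-- The radial profile in the case `k = 0`. -/
noncomputable def expProfile (H u : ℝ) : ℝ := H * Real.exp (-2 * u)

/-- The radial profile in the case `k > 0`. -/
noncomputable def powProfile (k : ℕ) (a u : ℝ) : ℝ := (a + 2 * k * u) ^ (-(k : ℝ)⁻¹)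

theorem isRadialProfile_expProfile {H : ℝ} (hH : 0 < H) : IsRadialProfile 0 (expProfile H) :=
  isRadialProfile_exp hH

theorem isRadialProfile_powProfile {k : ℕ} (hk : 0 < k) {a : ℝ} (ha : 0 < a) :
    IsRadialProfile k (powProfile k a) :=
  isRadialProfile_rpow hk ha

theorem exists_spiralRadius_exp_bounds {n : ℕ} (hn : Odd n) {H : ℝ} (hH : 0 < H) (φ₀ : ℝ) :
    ∃ A B : ℝ, 0 < A ∧ 0 < B ∧ ∀ φ, φ₀ ≤ φ →
      A * Real.exp (-(1 / (n : ℝ)) * φ) ≤ spiralRadius n (expProfile H) φ₀ φ ∧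
      spiralRadius n (expProfile H) φ₀ φ ≤ B * Real.exp (-(1 / (n : ℝ)) * φ) := by
  obtain ⟨M, hM0, hM⟩ := exists_generalizedAngle_bound hn φ₀
  have hn0 : (0 : ℝ) < n := by exact_mod_cast hn.pos
  have hG := isRadialProfile_expProfile hH
  set p : ℝ := ((2 * n : ℕ) : ℝ)⁻¹ with hp
  have hsplit : ∀ c u : ℝ, 0 < c → (c * expProfile H u) ^ p =
      (c * H) ^ p * Real.exp (-(1 / (n : ℝ)) * u) := by
    intro c u hc
    rw [expProfile, ← mul_assoc, Real.mul_rpow (by positivity) (Real.exp_pos _).le,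
      ← Real.exp_mul]
    congr 2
    rw [hp]; push_cast; field_simp
  -- The factors `2` and `2^n` come from the bounds on `angularNorm`, and `M` from replacing the
  -- generalized angle by the polar one.
  refine ⟨(2⁻¹ * H) ^ p * Real.exp (-(1 / (n : ℝ)) * M),
    (2 ^ n * H) ^ p * Real.exp (1 / (n : ℝ) * M), by positivity, by positivity, fun φ hφ => ⟨?_, ?_⟩⟩
  · have hle := le_spiralRadius hn hG hφ
    rw [div_eq_inv_mul, hsplit _ _ (by norm_num)] at hle
    refine le_trans ?_ hle
    rw [mul_assoc, ← Real.exp_add]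
    gcongr
    rw [← mul_add, neg_mul, neg_mul, neg_le_neg_iff]
    gcongr
    linarith [(abs_le.1 (hM φ)).2]
  · refine (spiralRadius_le hn hG hφ).trans ?_
    rw [hsplit _ _ (by positivity), mul_assoc, ← Real.exp_add]
    gcongr
    rw [neg_mul, neg_mul, ← sub_eq_add_neg, ← mul_sub, neg_le_iff_add_nonneg, ← mul_add]
    have := (abs_le.1 (hM φ)).1
    have : 0 ≤ M - φ + generalizedAngle n φ₀ φ := by linarith
    positivity

theorem posComparableExp_spiralRadius {n : ℕ} (hn : Odd n) {H : ℝ} (hH : 0 < H) (φ₀ : ℝ) :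
    PosComparableExp φ₀ (spiralRadius n (expProfile H) φ₀) (1 / (n : ℝ)) := by
  have hn0 : (0 : ℝ) < n := by exact_mod_cast hn.pos
  obtain ⟨A, B, hA, hB, h⟩ := exists_spiralRadius_exp_bounds hn hH φ₀
  refine ⟨by positivity, A, B, hA, hB, fun φ hφ => ?_⟩
  exact ⟨(le_div_iff₀ (Real.exp_pos _)).2 (h φ hφ.1).1,
    (div_le_iff₀ (Real.exp_pos _)).2 (h φ hφ.1).2⟩

/-- The generalized angle differs from `φ` by a bounded amount. The summand `1` in `φ - φ₀ + 1`
keeps the comparison meaningful at `φ = φ₀`. -/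
theorem exists_base_bounds {n k : ℕ} (hn : Odd n) (hk : 0 < k) {a : ℝ} (ha : 0 < a) (φ₀ : ℝ) :
    ∃ c C : ℝ, 0 < c ∧ 0 < C ∧ ∀ φ, φ₀ ≤ φ →
      c * (φ - φ₀ + 1) ≤ a + 2 * k * generalizedAngle n φ₀ φ ∧
      a + 2 * k * generalizedAngle n φ₀ φ ≤ C * (φ - φ₀ + 1) := by
  obtain ⟨M, hM0, hM⟩ := exists_generalizedAngle_bound hn φ₀
  have hk0 : (0 : ℝ) < k := by exact_mod_cast hk
  set D : ℝ := M + |φ₀| + 1 with hD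
  have hD1 : 1 ≤ D := by have := abs_nonneg φ₀; linarith
  -- With `x = φ - φ₀ + 1`, for `x ≤ 4D` the term `a` alone suffices. For `x ≥ 4D` the generalized
  -- angle is at least `x - 2D ≥ x / 2`, and the slope `2k` gives `k x`.
  refine ⟨min k (a / (4 * D)), a + 2 * k * D + 2 * k, lt_min hk0 (by positivity),
    by positivity, fun φ hφ => ?_⟩
  have hx : 1 ≤ φ - φ₀ + 1 := by linarith
  have h1 := abs_le.1 (hM φ)
  have h2 := abs_le.1 (le_refl |φ₀|)
  have h0 := generalizedAngle_nonneg hn hφ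
  have hWl : φ - φ₀ + 1 - 2 * D ≤ generalizedAngle n φ₀ φ := by
    linarith
  have hWu : generalizedAngle n φ₀ φ ≤ φ - φ₀ + 1 + D := by linarith
  set x := φ - φ₀ + 1
  set W := generalizedAngle n φ₀ φ
  constructor
  · rcases le_total x (4 * D) with hle | hle
    · calc min (k : ℝ) (a / (4 * D)) * x ≤ a / (4 * D) * (4 * D) := by
            gcongr
            exact min_le_right _ _
        _ = a := by field_simp
        _ ≤ _ := by
            have : 0 ≤ 2 * k * W := by positivity
            linarith
    · calc min (k : ℝ) (a / (4 * D)) * x ≤ k * x := by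
            gcongr
            exact min_le_left _ _
        _ ≤ _ := by nlinarith
  · nlinarith [mul_pos hk0 (show 0 < D by linarith), mul_nonneg (mul_nonneg hk0.le
      (show 0 ≤ D by linarith)) (show 0 ≤ x - 1 by linarith)]

theorem exists_spiralRadius_pow_bounds {n k : ℕ} (hn : Odd n) (hk : 0 < k) {a : ℝ} (ha : 0 < a)
    (φ₀ : ℝ) :
    ∃ A B : ℝ, 0 < A ∧ 0 < B ∧ ∀ φ, φ₀ ≤ φ →
      A * (φ - φ₀ + 1) ^ (-(1 / (2 * n * k : ℝ))) ≤ spiralRadius n (powProfile k a) φ₀ φ ∧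
      spiralRadius n (powProfile k a) φ₀ φ ≤ B * (φ - φ₀ + 1) ^ (-(1 / (2 * n * k : ℝ))) := by
  obtain ⟨c, C, hc, hC, hb⟩ := exists_base_bounds hn hk ha φ₀
  have hn0 : (0 : ℝ) < n := by exact_mod_cast hn.pos
  have hk0 : (0 : ℝ) < k := by exact_mod_cast hk
  have hG := isRadialProfile_powProfile hk ha
  set p : ℝ := ((2 * n : ℕ) : ℝ)⁻¹ with hp
  set α : ℝ := 1 / (2 * n * k : ℝ) with hα
  have hα0 : 0 < α := by positivity
  have hsplit : ∀ s u : ℝ, 0 < s → 0 ≤ u → (s * powProfile k a u) ^ p =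
      s ^ p * (a + 2 * k * u) ^ (-α) := by
    intro s u hs hu
    have hpos : 0 < a + 2 * k * u := by positivity
    rw [powProfile, Real.mul_rpow hs.le (by positivity), ← Real.rpow_mul hpos.le]
    congr 2
    rw [hp, hα]; push_cast; field_simp
  refine ⟨2⁻¹ ^ p * C ^ (-α), (2 ^ n) ^ p * c ^ (-α), by positivity, by positivity,
    fun φ hφ => ⟨?_, ?_⟩⟩
  · have hle := le_spiralRadius hn hG hφ
    have hx : 0 < φ - φ₀ + 1 := by linarith
    have hW := generalizedAngle_nonneg hn hφ
    have hpos : 0 < a + 2 * k * generalizedAngle n φ₀ φ := by positivity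
    rw [div_eq_inv_mul, hsplit _ _ (by norm_num) hW] at hle
    refine le_trans ?_ hle
    rw [mul_assoc, ← Real.mul_rpow hC.le hx.le]
    refine mul_le_mul_of_nonneg_left ?_ (by positivity)
    exact Real.rpow_le_rpow_of_nonpos hpos (hb φ hφ).2 (by linarith)
  · refine (spiralRadius_le hn hG hφ).trans ?_
    have hx : 0 < φ - φ₀ + 1 := by linarith
    have hW := generalizedAngle_nonneg hn hφ
    rw [hsplit _ _ (by positivity) hW, mul_assoc (_ ^ p), ← Real.mul_rpow hc.le hx.le]
    refine mul_le_mul_of_nonneg_left ?_ (by positivity)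
    exact Real.rpow_le_rpow_of_nonpos (by positivity) (hb φ hφ).1 (by linarith)

theorem posComparablePower_spiralRadius {n k : ℕ} (hn : Odd n) (hk : 0 < k) {a : ℝ} (ha : 0 < a)
    (φ₀ : ℝ) :
    PosComparablePower φ₀ (spiralRadius n (powProfile k a) φ₀) (1 / (2 * n * k : ℝ)) := by
  obtain ⟨A, B, hA, hB, h⟩ := exists_spiralRadius_pow_bounds hn hk ha φ₀
  have hn0 : (0 : ℝ) < n := by exact_mod_cast hn.pos
  have hk0 : (0 : ℝ) < k := by exact_mod_cast hk
  set α : ℝ := 1 / (2 * n * k : ℝ) with hα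
  have hα0 : 0 < α := by positivity
  have habs := abs_nonneg φ₀
  refine ⟨A * (2 + |φ₀|) ^ (-α), B * ((1 + |φ₀|)⁻¹) ^ (-α), by positivity, by positivity, ?_⟩
  rintro φ ⟨hφ : φ₀ ≤ φ, hφ1 : 1 ≤ φ⟩
  have hφ0 : 0 < φ := by linarith
  have hx : 1 ≤ φ - φ₀ + 1 := by linarith
  have h2 := abs_le.1 (le_refl |φ₀|)
  simp only [abs_of_pos hφ0]
  have hpow : 0 < φ ^ (-α) := by positivity
  constructor
  · rw [le_div_iff₀ hpow, mul_assoc, ← Real.mul_rpow (by positivity) hφ0.le]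
    refine le_trans ?_ (h φ hφ).1
    refine mul_le_mul_of_nonneg_left ?_ hA.le
    refine Real.rpow_le_rpow_of_nonpos (by linarith) ?_ (by linarith)
    nlinarith
  · rw [div_le_iff₀ hpow, mul_assoc, ← Real.mul_rpow (by positivity) hφ0.le]
    refine (h φ hφ).2.trans ?_
    refine mul_le_mul_of_nonneg_left ?_ hB.le
    refine Real.rpow_le_rpow_of_nonpos (by positivity) ?_ (by linarith)
    rw [inv_mul_le_iff₀ (by positivity)]
    nlinarith

/-- Radii one turn apart have ratio `ρ^(1/(2nk))` with `ρ = b / (b + 4πk)`. As the exponent is at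
most `1` and `ρ ≤ 1`, this is at least `ρ`, and `1 - ρ ≤ 4πk / b`. -/
theorem spiralRadius_pow_gap {n k : ℕ} (hn : Odd n) (hk : 0 < k) {a : ℝ} (ha : 0 < a)
    {φ₀ φ : ℝ} (hφ : φ₀ ≤ φ) :
    spiralRadius n (powProfile k a) φ₀ φ - spiralRadius n (powProfile k a) φ₀ (φ + 2 * Real.pi) ≤
      spiralRadius n (powProfile k a) φ₀ φ *
        (4 * Real.pi * k / (a + 2 * k * generalizedAngle n φ₀ φ)) := by
  have hn0 : (0 : ℝ) < n := by exact_mod_cast hn.pos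
  have hn1 : (1 : ℝ) ≤ n := by exact_mod_cast hn.pos
  have hk0 : (0 : ℝ) < k := by exact_mod_cast hk
  have hk1 : (1 : ℝ) ≤ k := by exact_mod_cast hk
  have hpi := Real.pi_pos
  have hW := generalizedAngle_nonneg hn hφ
  have hh := angularNorm_pos n φ
  have hf := spiralRadius_pos hn (isRadialProfile_powProfile hk ha) hφ
  set b := a + 2 * k * generalizedAngle n φ₀ φ with hb
  have hb0 : 0 < b := by positivity
  set p : ℝ := ((2 * n : ℕ) : ℝ)⁻¹ with hp
  set ρ := b / (b + 4 * Real.pi * k) with hρ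
  have hρ0 : 0 < ρ := by positivity
  have hρ1 : ρ ≤ 1 := by rw [hρ, div_le_one (by positivity)]; have : 0 < 4 * Real.pi * k := by positivity
                         linarith
  have hnext : spiralRadius n (powProfile k a) φ₀ (φ + 2 * Real.pi) =
      spiralRadius n (powProfile k a) φ₀ φ * ρ ^ ((k : ℝ)⁻¹ * p) := by
    rw [spiralRadius, spiralRadius, angularNorm_add_two_pi, generalizedAngle_add_two_pi hn,
      powProfile, powProfile, ← hb, Real.rpow_mul hρ0.le, ← Real.mul_rpow (by positivity)
      (by positivity)]
    congr 1
    rw [show a + 2 * k * (generalizedAngle n φ₀ φ + 2 * Real.pi) = b + 4 * Real.pi * k by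
      rw [hb]; ring, hρ, Real.div_rpow hb0.le (by positivity), Real.rpow_neg hb0.le,
      Real.rpow_neg (by positivity)]
    have : 0 < b ^ (k : ℝ)⁻¹ := by positivity
    field_simp
  have hexp : ρ ≤ ρ ^ ((k : ℝ)⁻¹ * p) := by
    refine Real.self_le_rpow_of_le_one hρ0.le hρ1 ?_
    have h1 : (k : ℝ)⁻¹ ≤ 1 := inv_le_one_of_one_le₀ hk1
    have h2 : p ≤ 1 := inv_le_one_of_one_le₀ (by push_cast; linarith)
    have h3 : 0 ≤ p := by positivity
    exact mul_le_one₀ h1 h3 h2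
  rw [hnext]
  have hle : 1 - ρ ≤ 4 * Real.pi * k / b := by
    have e : 1 - ρ = 4 * Real.pi * k / (b + 4 * Real.pi * k) := by rw [hρ]; field_simp; ring
    rw [e]
    gcongr
    have : 0 < 4 * Real.pi * k := by positivity
    linarith
  nlinarith

/-- With respect to the polar angle the speed is `r √(ℓ^2 + 1)`, where the logarithmic rate `ℓ` is
bounded. A parametrization with bounded `r |ψ'|` is therefore Lipschitz, and lengths can be read off
from the length of the parameter interval. -/
theorem exists_spiralCurve_lipschitz {n k : ℕ} {G : ℝ → ℝ} (hn : Odd n)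
    (hG : IsRadialProfile k G) (φ₀ : ℝ) :
    ∃ L, 0 < L ∧ ∀ (S : Set ℝ) (ψ ψ' : ℝ → ℝ) (K : ℝ), Convex ℝ S → (∀ u ∈ S, φ₀ ≤ ψ u) →
      (∀ u ∈ S, HasDerivAt ψ (ψ' u) u) → (∀ u ∈ S, spiralRadius n G φ₀ (ψ u) * |ψ' u| ≤ K) →
      ∀ x ∈ S, ∀ y ∈ S, dist (spiralCurve n G φ₀ (ψ x)) (spiralCurve n G φ₀ (ψ y)) ≤
        L * K * |x - y| := by
  obtain ⟨L, hL, hℓ⟩ := exists_radialRate_bound hn hG φ₀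
  refine ⟨L + 1, by positivity, fun S ψ ψ' K hS hψ hd hK x hx y hy => ?_⟩
  have hnorm : ∀ φ, φ₀ ≤ φ → ‖(!₂[radialRate n k G φ₀ φ * Real.cos φ - Real.sin φ,
      radialRate n k G φ₀ φ * Real.sin φ + Real.cos φ] : EuclideanSpace ℝ (Fin 2))‖ ≤ L + 1 := by
    intro φ hφ
    refine le_of_sq_le_sq ?_ (by positivity)
    rw [norm_sq_plane]
    have h1 : radialRate n k G φ₀ φ ^ 2 ≤ L ^ 2 := by
      rw [← sq_abs]
      exact pow_le_pow_left₀ (abs_nonneg _) (hℓ φ hφ) 2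
    have h2 := Real.cos_sq_add_sin_sq φ
    have h3 : (radialRate n k G φ₀ φ * Real.cos φ - Real.sin φ) ^ 2 +
      (radialRate n k G φ₀ φ * Real.sin φ + Real.cos φ) ^ 2 = radialRate n k G φ₀ φ ^ 2 + 1 := by
      linear_combination (radialRate n k G φ₀ φ ^ 2 + 1) * h2
    simp only [Matrix.cons_val_zero, Matrix.cons_val_one, Matrix.cons_val_fin_one]
    rw [h3]
    nlinarith
  rw [dist_eq_norm]
  refine hS.norm_image_sub_le_of_norm_hasDerivWithin_le
    (f := fun u => spiralCurve n G φ₀ (ψ u)) (fun u hu =>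
      ((hasDerivAt_spiralCurve hn hG (hψ u hu)).scomp u (hd u hu)).hasDerivWithinAt)
    (fun u hu => ?_) hy hx
  have hr := spiralRadius_pos hn hG (hψ u hu)
  rw [norm_smul, norm_smul, Real.norm_eq_abs, Real.norm_eq_abs, abs_of_pos hr]
  calc _ = spiralRadius n G φ₀ (ψ u) * |ψ' u| * _ := by rw [← mul_assoc, mul_comm |ψ' u|]
    _ ≤ K * (L + 1) := by
      have := hK u hu
      have := hnorm _ (hψ u hu)
      have : 0 ≤ K := le_trans (by positivity) (hK u hu)
      gcongr
    _ = _ := mul_comm _ _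

/-! ### Measurability in the case `k = 0` -/

/-- The logarithmic derivative of the radius when `k = 0`. -/
noncomputable def homogeneousRate (n : ℕ) (φ : ℝ) : ℝ :=
  (Real.cos φ ^ (2 * n - 1) * Real.sin φ - Real.sin φ ^ (2 * n - 1) * Real.cos φ
    - (Real.cos φ * Real.sin φ) ^ (n - 1)) / angularNorm n φ

theorem contDiff_homogeneousRate (n : ℕ) : ContDiff ℝ 1 (homogeneousRate n) := by
  unfold homogeneousRate
  refine ContDiff.div (by fun_prop) ?_ fun φ => (angularNorm_pos n φ).ne'
  unfold angularNorm
  fun_prop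

/-- Moving the base angle only rescales `H`. Facts proved for angles beyond the base thus hold at
every angle, as needed for a framed curve defined on the whole line. -/
theorem spiralRadius_exp_rebase (n : ℕ) (H φ₀ φ₁ φ : ℝ) :
    spiralRadius n (expProfile H) φ₀ φ =
      spiralRadius n (expProfile (H * Real.exp (-2 * generalizedAngle n φ₀ φ₁))) φ₁ φ := by
  have hi : ∀ a b, IntervalIntegrable (angularSpeed n) volume a b := fun a b =>
    (continuous_angularSpeed n).continuousOn.intervalIntegrable
  have hadd : generalizedAngle n φ₀ φ = generalizedAngle n φ₀ φ₁ + generalizedAngle n φ₁ φ :=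
    (intervalIntegral.integral_add_adjacent_intervals (hi _ _) (hi _ _)).symm
  rw [spiralRadius, spiralRadius, hadd, expProfile, expProfile, mul_assoc, ← Real.exp_add, mul_add]

theorem hasDerivAt_spiralCurve_exp {n : ℕ} (hn : Odd n) {H : ℝ} (hH : 0 < H) (φ₀ φ : ℝ) :
    HasDerivAt (spiralCurve n (expProfile H) φ₀)
      (spiralRadius n (expProfile H) φ₀ φ • !₂[homogeneousRate n φ * Real.cos φ - Real.sin φ,
        homogeneousRate n φ * Real.sin φ + Real.cos φ]) φ := by
  have hH' : 0 < H * Real.exp (-2 * generalizedAngle n φ₀ φ) := by positivity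
  have h := hasDerivAt_spiralCurve hn (isRadialProfile_expProfile hH') (le_refl φ)
  have hfun : spiralCurve n (expProfile H) φ₀ =
      spiralCurve n (expProfile (H * Real.exp (-2 * generalizedAngle n φ₀ φ))) φ := by
    ext1 x
    rw [spiralCurve, spiralCurve, spiralRadius_exp_rebase n H φ₀ φ]
  have hrate : ∀ G ψ, radialRate n 0 G ψ φ = homogeneousRate n φ := fun G ψ => by
    rw [radialRate, homogeneousRate, pow_zero, mul_one]
  rw [hrate, ← spiralRadius_exp_rebase] at h
  rwa [hfun]

/-- The ratio of the speed of the spiral to its radius, when `k = 0`. -/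
noncomputable def speedFactor (n : ℕ) (φ : ℝ) : ℝ := √(1 + homogeneousRate n φ ^ 2)

theorem speedFactor_pos (n : ℕ) (φ : ℝ) : 0 < speedFactor n φ :=
  Real.sqrt_pos.2 (by positivity)

theorem contDiff_speedFactor (n : ℕ) : ContDiff ℝ 1 (speedFactor n) := by
  have := contDiff_homogeneousRate n
  unfold speedFactor
  exact ContDiff.sqrt (by fun_prop) fun φ => by positivity

/-- The unit normal of the spiral when `k = 0`. -/
noncomputable def spiralNormal (n : ℕ) (φ : ℝ) : EuclideanSpace ℝ (Fin 2) :=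
  !₂[-(homogeneousRate n φ * Real.sin φ + Real.cos φ) / speedFactor n φ,
    (homogeneousRate n φ * Real.cos φ - Real.sin φ) / speedFactor n φ]

theorem contDiff_spiralNormal (n : ℕ) : ContDiff ℝ 1 (spiralNormal n) := by
  have h1 := contDiff_homogeneousRate n
  have h2 := contDiff_speedFactor n
  refine contDiff_euclidean.2 fun i => ?_
  fin_cases i
  · exact ContDiff.div (by fun_prop) h2 fun φ => (speedFactor_pos n φ).ne'
  · exact ContDiff.div (by fun_prop) h2 fun φ => (speedFactor_pos n φ).ne'

/-- For `k = 0` the logarithmic rate, and with it the normal direction, is a smooth function of the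
angle alone. -/
theorem isFramedCurve_spiralCurve_exp {n : ℕ} (hn : Odd n) {H : ℝ} (hH : 0 < H) (φ₀ : ℝ) :
    IsFramedCurve (spiralCurve n (expProfile H) φ₀) (spiralNormal n) (deriv (spiralNormal n))
      (fun φ => spiralRadius n (expProfile H) φ₀ φ * speedFactor n φ) where
  hasDerivAt φ := by
    refine (hasDerivAt_spiralCurve_exp hn hH φ₀ φ).congr_deriv ?_
    have := (speedFactor_pos n φ).ne'
    ext i
    fin_cases i <;> simp [spiralNormal] <;> field_simp
    ring
  normal_hasDerivAt φ := ((contDiff_spiralNormal n).differentiable one_ne_zero φ).hasDerivAt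
  unit φ := by
    have hs := (speedFactor_pos n φ).ne'
    have hsq : speedFactor n φ ^ 2 = 1 + homogeneousRate n φ ^ 2 := Real.sq_sqrt (by positivity)
    simp only [spiralNormal, PiLp.toLp_apply, Matrix.cons_val_zero, Matrix.cons_val_one,
      Matrix.cons_val_fin_one]
    rw [div_pow, div_pow, ← add_div, div_eq_one_iff_eq (pow_ne_zero 2 hs), hsq]
    linear_combination (1 + homogeneousRate n φ ^ 2) * Real.cos_sq_add_sin_sq φ
  speed_pos φ := by
    have hH' : 0 < H * Real.exp (-2 * generalizedAngle n φ₀ φ) := by positivity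
    have := spiralRadius_pos hn (isRadialProfile_expProfile hH') (le_refl φ)
    rw [← spiralRadius_exp_rebase] at this
    exact mul_pos this (speedFactor_pos n φ)
  speed_continuous := by
    refine Continuous.mul (continuous_iff_continuousAt.2 fun φ => ?_)
      (contDiff_speedFactor n).continuous
    have hH' : 0 < H * Real.exp (-2 * generalizedAngle n φ₀ φ) := by positivity
    have := (hasDerivAt_spiralRadius hn (isRadialProfile_expProfile hH') (le_refl φ)).continuousAt
    have hfun : spiralRadius n (expProfile H) φ₀ =
        spiralRadius n (expProfile (H * Real.exp (-2 * generalizedAngle n φ₀ φ))) φ :=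
      funext fun x => spiralRadius_exp_rebase n H φ₀ φ x
    rwa [hfun]
  normal_deriv_continuous := (contDiff_spiralNormal n).continuous_deriv le_rfl

theorem exists_volume_tail_exp_le {n : ℕ} (hn : Odd n) {H : ℝ} (hH : 0 < H) (φ₀ : ℝ) :
    ∃ D : ℝ, 0 < D ∧ ∀ b, φ₀ ≤ b → ∀ ε, 0 < ε →
      volume (Metric.thickening ε (spiralCurve n (expProfile H) φ₀ '' Ici b)) ≤
        ENNReal.ofReal (4 * Real.pi * (D * Real.exp (-(1 / (n : ℝ)) * b) + ε) * ε) := by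
  have hn0 : (0 : ℝ) < n := by exact_mod_cast hn.pos
  obtain ⟨A, B, hA, hB, hAB⟩ := exists_spiralRadius_exp_bounds hn hH φ₀
  obtain ⟨L, hL, hLip⟩ := exists_spiralCurve_lipschitz hn (isRadialProfile_expProfile hH) φ₀
  refine ⟨L * (n * B), by positivity, fun b hb ε hε => ?_⟩
  set E := Real.exp (-(1 / (n : ℝ)) * b) with hE
  -- The parameter `u = exp (-φ/n)` maps `φ ≥ b` onto `(0, E]`. As `r` is at most `B u` and `|dφ/du|
  -- = n / u`, the speed is bounded and the length is of order at most `E`.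
  have hψ : ∀ u ∈ Ioc 0 E, b ≤ -(n * Real.log u) := by
    intro u hu
    have h1 := Real.log_le_log hu.1 hu.2
    rw [hE, Real.log_exp] at h1
    have h2 := mul_le_mul_of_nonneg_left h1 hn0.le
    rw [← mul_assoc, mul_neg, mul_one_div_cancel hn0.ne'] at h2
    linarith
  have himg : spiralCurve n (expProfile H) φ₀ '' Ici b =
      (fun u => spiralCurve n (expProfile H) φ₀ (-(n * Real.log u))) '' Ioc 0 E := by
    ext p
    constructor
    · rintro ⟨φ, hφ, rfl⟩
      refine ⟨Real.exp (-(1 / (n : ℝ)) * φ), ⟨Real.exp_pos _, Real.exp_le_exp.2 ?_⟩, ?_⟩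
      · rw [neg_mul, neg_mul, neg_le_neg_iff]
        have : b ≤ φ := hφ
        gcongr
      · simp only [Real.log_exp]
        congr 1
        field_simp
    · rintro ⟨u, hu, rfl⟩
      exact ⟨_, hψ u hu, rfl⟩
  rw [himg]
  have hlip := hLip (Ioc 0 E) (fun u => -(n * Real.log u)) (fun u => -(n * u⁻¹)) (n * B)
    (convex_Ioc 0 E) (fun u hu => hb.trans (hψ u hu))
    (fun u hu => ((Real.hasDerivAt_log hu.1.ne').const_mul _).neg) (fun u hu => by
      have h1 := (hAB _ (hb.trans (hψ u hu))).2
      have e : -(1 / (n : ℝ)) * -(n * Real.log u) = Real.log u := by field_simp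
      rw [e, Real.exp_log hu.1] at h1
      have hu0 := hu.1
      rw [abs_neg, abs_of_pos (by positivity)]
      calc _ ≤ B * u * (n * u⁻¹) := by gcongr
        _ = n * B := by field_simp)
  have := volume_thickening_lipschitz_le (a := 0) (b := E) (by positivity) Ioc_subset_Icc_self hε hlip
  rwa [sub_zero] at this

theorem minkowski_spiralCurve_exp {n : ℕ} (hn : Odd n) {H : ℝ} (hH : 0 < H) (φ₀ : ℝ) :
    HasBoxDim (spiralCurve n (expProfile H) φ₀ '' Ici φ₀) 1 ∧
      IsMinkowskiMeasurable (spiralCurve n (expProfile H) φ₀ '' Ici φ₀) := by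
  have hn0 : (0 : ℝ) < n := by exact_mod_cast hn.pos
  have hG := isRadialProfile_expProfile hH
  have hframe := isFramedCurve_spiralCurve_exp hn hH φ₀
  obtain ⟨D, hD, htail⟩ := exists_volume_tail_exp_le hn hH φ₀
  set c := spiralCurve n (expProfile H) φ₀ with hc
  set g : ℝ → ℝ := fun φ => spiralRadius n (expProfile H) φ₀ φ * speedFactor n φ with hg
  set A := c '' Ici φ₀ with hA
  -- The bound for the contribution of the angles beyond `b`, after division by `ε` and passage to
  -- the limit `ε → 0`. It tends to `0` as `b → ∞`, which closes the gap between `hlower` and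
  -- `hupper`.
  let δ : ℝ → ℝ≥0∞ := fun b => ENNReal.ofReal (4 * Real.pi * (D * Real.exp (-(1 / (n : ℝ)) * b)))
  have hden : ∀ ε : ℝ, ENNReal.ofReal (ε ^ (((2 : ℕ) : ℝ) - 1)) = ENNReal.ofReal ε := by
    intro ε; norm_num
  have hl : lowerMinkowskiContent 1 A =
      liminf (fun ε : ℝ => volume (Metric.thickening ε A) / ENNReal.ofReal ε) (𝓝[>] 0) := by
    simp only [lowerMinkowskiContent, hden]
  have hu : upperMinkowskiContent 1 A =
      limsup (fun ε : ℝ => volume (Metric.thickening ε A) / ENNReal.ofReal ε) (𝓝[>] 0) := by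
    simp only [upperMinkowskiContent, hden]
  have harc : ∀ b, φ₀ ≤ b →
      Tendsto (fun ε : ℝ => volume (Metric.thickening ε (c '' Icc φ₀ b)) / ENNReal.ofReal ε)
        (𝓝[>] 0) (𝓝 (2 * IsFramedCurve.arcLength g φ₀ b)) := fun b hb =>
    hframe.tendsto_volume_thickening hb ((injOn_spiralCurve hn hG φ₀).mono Icc_subset_Ici_self)
  have hlower : ∀ b, φ₀ ≤ b →
      2 * IsFramedCurve.arcLength g φ₀ b ≤ lowerMinkowskiContent 1 A := by
    intro b hb
    rw [hl, ← (harc b hb).liminf_eq]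
    refine liminf_le_liminf (Eventually.of_forall fun ε => ?_)
    gcongr
    exact Metric.thickening_subset_of_subset _ (image_mono Icc_subset_Ici_self)
  have hupper : ∀ b, φ₀ ≤ b →
      upperMinkowskiContent 1 A ≤ 2 * IsFramedCurve.arcLength g φ₀ b + δ b := by
    intro b hb
    have hlim : Tendsto (fun ε : ℝ => ENNReal.ofReal
        (4 * Real.pi * (D * Real.exp (-(1 / (n : ℝ)) * b) + ε))) (𝓝[>] 0) (𝓝 (δ b)) := by
      refine ENNReal.tendsto_ofReal (Tendsto.mono_left ?_ nhdsWithin_le_nhds)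
      have : Continuous fun ε : ℝ => 4 * Real.pi * (D * Real.exp (-(1 / (n : ℝ)) * b) + ε) := by
        fun_prop
      simpa using this.tendsto 0
    rw [hu, ← ((harc b hb).add hlim).limsup_eq]
    refine limsup_le_limsup ?_
    filter_upwards [self_mem_nhdsWithin] with ε (hε : 0 < ε)
    have hε0 : ENNReal.ofReal ε ≠ 0 := by simpa using hε
    have hAu : A = c '' Icc φ₀ b ∪ c '' Ici b := by
      rw [← image_union, Icc_union_Ici_eq_Ici hb]
    have htb := htail b hb ε hε
    rw [ENNReal.ofReal_mul (by positivity)] at htb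
    calc _ ≤ (volume (Metric.thickening ε (c '' Icc φ₀ b)) +
          volume (Metric.thickening ε (c '' Ici b))) / ENNReal.ofReal ε := by
            gcongr
            rw [hAu, Metric.thickening_union]
            exact measure_union_le _ _
      _ ≤ _ := by
            rw [ENNReal.add_div]
            gcongr
            exact ENNReal.div_le_of_le_mul htb
  have hle := lowerMinkowskiContent_le_upper 1 A
  have hge : upperMinkowskiContent 1 A ≤ lowerMinkowskiContent 1 A := by
    have hδ : Tendsto δ atTop (𝓝 0) := by
      have h1 : Tendsto (fun b : ℝ => -(1 / (n : ℝ)) * b) atTop atBot :=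
        tendsto_id.const_mul_atTop_of_neg (by rw [neg_lt_zero]; positivity)
      have h2 := ((Real.tendsto_exp_atBot.comp h1).const_mul D).const_mul (4 * Real.pi)
      rw [mul_zero, mul_zero] at h2
      have h3 := ENNReal.tendsto_ofReal h2
      rwa [ENNReal.ofReal_zero] at h3
    have h3 := (tendsto_const_nhds (x := lowerMinkowskiContent 1 A)).add hδ
    rw [add_zero] at h3
    refine ge_of_tendsto h3 ?_
    filter_upwards [eventually_ge_atTop φ₀] with b hb
    exact (hupper b hb).trans (by gcongr; exact hlower b hb)
  have hfin : upperMinkowskiContent 1 A < ∞ := by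
    refine (hupper φ₀ le_rfl).trans_lt ?_
    simp [IsFramedCurve.arcLength, δ]
  have hpos : 0 < lowerMinkowskiContent 1 A := by
    refine lt_of_lt_of_le ?_ (hlower (φ₀ + 1) (by linarith))
    refine ENNReal.mul_pos two_ne_zero (ne_of_gt ?_)
    rw [IsFramedCurve.arcLength, setLIntegral_pos_iff hframe.speed_continuous.measurable.ennreal_ofReal]
    have : Function.support (fun t => ENNReal.ofReal (g t)) = univ := by
      ext t
      simpa using hframe.speed_pos t
    rw [this, univ_inter, Real.volume_Ioo]
    simp
  exact ⟨hasBoxDim_of_contents (isBounded_spiralCurve hn hG φ₀) zero_le_one hpos hfin,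
    1, zero_le_one, le_antisymm hle hge, hpos, hle.trans_lt hfin⟩

/-! ### Nondegeneracy in the case `k > 0` -/

/-- The part of a power spiral with `φ - φ₀ + 1 ≤ X` has length of order `X^(1-α)`. -/
theorem exists_volume_nucleus_le {n k : ℕ} {G : ℝ → ℝ} (hn : Odd n) (hG : IsRadialProfile k G)
    {φ₀ α B : ℝ} (hα1 : α < 1) (hB : 0 < B)
    (hf : ∀ φ, φ₀ ≤ φ → spiralRadius n G φ₀ φ ≤ B * (φ - φ₀ + 1) ^ (-α)) :
    ∃ D : ℝ, 0 < D ∧ ∀ X, 1 ≤ X → ∀ ε, 0 < ε →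
      volume (Metric.thickening ε (spiralCurve n G φ₀ '' Icc φ₀ (φ₀ - 1 + X))) ≤
        ENNReal.ofReal (4 * Real.pi * (D * X ^ (1 - α) + ε) * ε) := by
  obtain ⟨L, hL, hLip⟩ := exists_spiralCurve_lipschitz hn hG φ₀
  have hα1' : 0 < 1 - α := by linarith
  refine ⟨L * (B * (1 - α)⁻¹), by positivity, fun X hX ε hε => ?_⟩
  set E := X ^ (1 - α) with hE
  -- With the parameter `u = (φ - φ₀ + 1)^(1-α)` the factor `r |ψ'|` is bounded by a constant: the
  -- powers of `u` cancel.
  let ψ : ℝ → ℝ := fun u => u ^ (1 - α)⁻¹ + (φ₀ - 1)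
  have hψ : ∀ u ∈ Icc 1 E, φ₀ ≤ ψ u := fun u hu => by
    have := Real.one_le_rpow hu.1 (inv_pos.2 hα1').le
    simp only [ψ]; linarith
  have himg : spiralCurve n G φ₀ '' Icc φ₀ (φ₀ - 1 + X) ⊆
      (fun u => spiralCurve n G φ₀ (ψ u)) '' Icc 1 E := by
    rintro _ ⟨φ, hφ, rfl⟩
    have hx : 1 ≤ φ - φ₀ + 1 := by linarith [hφ.1]
    refine ⟨(φ - φ₀ + 1) ^ (1 - α), ⟨Real.one_le_rpow hx hα1'.le, ?_⟩, ?_⟩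
    · exact Real.rpow_le_rpow (by linarith) (by linarith [hφ.2]) hα1'.le
    · simp only [ψ]
      rw [← Real.rpow_mul (by linarith), mul_inv_cancel₀ hα1'.ne', Real.rpow_one]
      congr 1; ring
  have hlip := hLip (Icc 1 E) ψ (fun u => (1 - α)⁻¹ * u ^ ((1 - α)⁻¹ - 1)) (B * (1 - α)⁻¹)
    (convex_Icc 1 E) hψ (fun u hu => (Real.hasDerivAt_rpow_const
      (Or.inl (by linarith [hu.1]))).add_const _) (fun u hu => by
      have hu0 : 0 < u := by linarith [hu.1]
      have h1 := hf _ (hψ u hu)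
      have e1 : ψ u - φ₀ + 1 = u ^ (1 - α)⁻¹ := by simp only [ψ]; ring
      rw [e1, ← Real.rpow_mul hu0.le] at h1
      have e2 : u ^ ((1 - α)⁻¹ * -α) * u ^ ((1 - α)⁻¹ - 1) = 1 := by
        rw [← Real.rpow_add hu0, show (1 - α)⁻¹ * -α + ((1 - α)⁻¹ - 1) = 0 by field_simp; ring,
          Real.rpow_zero]
      rw [abs_of_pos (by positivity)]
      calc _ ≤ B * u ^ ((1 - α)⁻¹ * -α) * ((1 - α)⁻¹ * u ^ ((1 - α)⁻¹ - 1)) := by gcongr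
        _ = B * (1 - α)⁻¹ * (u ^ ((1 - α)⁻¹ * -α) * u ^ ((1 - α)⁻¹ - 1)) := by ring
        _ = _ := by rw [e2, mul_one])
  refine (measure_mono (Metric.thickening_subset_of_subset ε himg)).trans
    ((volume_thickening_lipschitz_le (by positivity) Subset.rfl hε hlip).trans ?_)
  apply ENNReal.ofReal_le_ofReal
  have : 0 < Real.pi := Real.pi_pos
  gcongr
  linarith

/-- The spiral is cut where turns become about `ε` apart. The outer part is estimated by its length,
the inner part by the disc that contains it. -/
theorem exists_volume_thickening_pow_le {n k : ℕ} {G : ℝ → ℝ} (hn : Odd n)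
    (hG : IsRadialProfile k G) {φ₀ α B : ℝ} (hα0 : 0 < α) (hα1 : α < 1) (hB : 0 < B)
    (hf : ∀ φ, φ₀ ≤ φ → spiralRadius n G φ₀ φ ≤ B * (φ - φ₀ + 1) ^ (-α)) :
    ∃ C : ℝ, 0 ≤ C ∧ ∀ ε, 0 < ε → ε < 1 →
      volume (Metric.thickening ε (spiralCurve n G φ₀ '' Ici φ₀)) ≤
        ENNReal.ofReal (C * ε ^ (2 * (α / (1 + α)))) := by
  obtain ⟨D, hD, hnuc⟩ := exists_volume_nucleus_le hn hG hα1 hB hf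
  have hpi := Real.pi_pos
  refine ⟨4 * Real.pi * (D + 1) + (B + 1) ^ 2 * Real.pi, by positivity, fun ε hε hε1 => ?_⟩
  have hα1' : 0 < 1 + α := by linarith
  set β := α / (1 + α) with hβ
  have hβ0 : 0 < β := by positivity
  have hβ1 : 2 * β ≤ 1 := by rw [hβ, ← mul_div_assoc, div_le_one hα1']; linarith
  -- This choice balances the two estimates: `ε X^(1-α)` and `(X^(-α))^2` both equal `ε^(2β)`.
  set X := ε ^ (-(1 / (1 + α))) with hX
  have hX1 : 1 ≤ X := Real.one_le_rpow_of_pos_of_le_one_of_nonpos hε hε1.le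
    (by rw [neg_nonpos]; positivity)
  have hXα : X ^ (-α) = ε ^ β := by
    rw [hX, ← Real.rpow_mul hε.le]; congr 1; rw [hβ]; field_simp
  have hXl : ε * X ^ (1 - α) = ε ^ (2 * β) := by
    rw [hX, ← Real.rpow_mul hε.le]
    nth_rewrite 1 [← Real.rpow_one ε]
    rw [← Real.rpow_add hε]; congr 1; rw [hβ]; field_simp; ring
  have hεβ : ε ≤ ε ^ β := by
    simpa using Real.rpow_le_rpow_of_exponent_ge hε hε1.le (show β ≤ 1 by linarith)
  have hεβ2 : ε ≤ ε ^ (2 * β) := by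
    simpa using Real.rpow_le_rpow_of_exponent_ge hε hε1.le hβ1
  have hsq : (ε ^ β) ^ 2 = ε ^ (2 * β) := by
    rw [← Real.rpow_natCast, ← Real.rpow_mul hε.le]; congr 1; push_cast; ring
  have hsplit : spiralCurve n G φ₀ '' Ici φ₀ =
      spiralCurve n G φ₀ '' Icc φ₀ (φ₀ - 1 + X) ∪ spiralCurve n G φ₀ '' Ici (φ₀ - 1 + X) := by
    rw [← image_union, Icc_union_Ici_eq_Ici (by linarith)]
  have htail : Metric.thickening ε (spiralCurve n G φ₀ '' Ici (φ₀ - 1 + X)) ⊆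
      Metric.ball 0 ((B + 1) * ε ^ β) := by
    intro p hp
    obtain ⟨_, ⟨φ, hφ, rfl⟩, hd⟩ := Metric.mem_thickening_iff.1 hp
    have hφ' : φ₀ - 1 + X ≤ φ := hφ
    have hφ0 : φ₀ ≤ φ := by linarith
    have hr : spiralRadius n G φ₀ φ ≤ B * ε ^ β := by
      refine (hf φ hφ0).trans ?_
      rw [← hXα]
      refine mul_le_mul_of_nonneg_left ?_ hB.le
      exact Real.rpow_le_rpow_of_nonpos (by linarith) (by linarith) (by linarith)
    have hnorm : dist (spiralCurve n G φ₀ φ) 0 = spiralRadius n G φ₀ φ := by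
      rw [dist_zero_right, spiralCurve, norm_polarPoint (spiralRadius_pos hn hG hφ0).le]
    rw [Metric.mem_ball]
    have := dist_triangle p (spiralCurve n G φ₀ φ) 0
    linarith
  rw [hsplit, Metric.thickening_union]
  refine (measure_union_le _ _).trans ((add_le_add (hnuc X hX1 ε hε)
    (measure_mono htail)).trans ?_)
  rw [EuclideanSpace.volume_ball_fin_two, ← ENNReal.ofReal_pow (by positivity),
    ← ENNReal.ofReal_mul (by positivity), ← ENNReal.ofReal_add (by positivity) (by positivity)]
  apply ENNReal.ofReal_le_ofReal
  have h1 : (D * X ^ (1 - α) + ε) * ε ≤ (D + 1) * ε ^ (2 * β) := by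
    have : ε * ε ≤ ε ^ (2 * β) := by nlinarith
    calc _ = D * (ε * X ^ (1 - α)) + ε * ε := by ring
      _ ≤ _ := by rw [hXl]; linarith
  have h2 : ((B + 1) * ε ^ β) ^ 2 * Real.pi = (B + 1) ^ 2 * Real.pi * ε ^ (2 * β) := by
    rw [mul_pow, hsq]; ring
  rw [h2, mul_assoc (4 * Real.pi)]
  nlinarith [mul_le_mul_of_nonneg_left h1 (show 0 ≤ 4 * Real.pi by positivity)]

/-- A punctured disc lies in the `ε`-neighbourhood of a spiral whose successive turns are closer
than `ε`. -/
theorem ball_subset_thickening_spiralCurve {n k : ℕ} {G : ℝ → ℝ} (hn : Odd n)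
    (hG : IsRadialProfile k G) {φ₀ φ₁ ρ ε : ℝ} (hφ₁ : φ₀ ≤ φ₁) (hε : 0 < ε)
    (hρ : ∀ φ ∈ Icc φ₁ (φ₁ + 2 * Real.pi), ρ ≤ spiralRadius n G φ₀ φ)
    (hgap : ∀ φ, φ₁ ≤ φ →
      spiralRadius n G φ₀ φ - spiralRadius n G φ₀ (φ + 2 * Real.pi) < ε) :
    Metric.ball 0 ρ ⊆ Metric.thickening ε (spiralCurve n G φ₀ '' Ici φ₀) := by
  have hpi := Real.pi_pos
  have hlim := tendsto_spiralRadius hn hG φ₀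
  intro p hp
  rw [mem_ball_zero_iff] at hp
  rw [Metric.mem_thickening_iff]
  rcases eq_or_ne p 0 with rfl | hp0
  · obtain ⟨φ, hφε, hφ⟩ := ((hlim.eventually (gt_mem_nhds hε)).and
      (eventually_ge_atTop φ₀)).exists
    refine ⟨_, mem_image_of_mem _ hφ, ?_⟩
    rwa [dist_zero_left, spiralCurve, norm_polarPoint (spiralRadius_pos hn hG hφ).le]
  obtain ⟨ϑ, hϑ⟩ := exists_polarPoint_eq p
  set a := toIcoMod Real.two_pi_pos φ₁ ϑ with ha
  have haI := toIcoMod_mem_Ico Real.two_pi_pos φ₁ ϑ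
  have hpa : ∀ m : ℕ, p = polarPoint ‖p‖ (a + m * (2 * Real.pi)) := by
    intro m
    have e : a + m * (2 * Real.pi) = ϑ - (toIcoDiv Real.two_pi_pos φ₁ ϑ : ℤ) * (2 * Real.pi)
        + m * (2 * Real.pi) := by
      rw [ha, toIcoMod, zsmul_eq_mul]
    rw [e, polarPoint, Real.cos_add_nat_mul_two_pi, Real.cos_sub_int_mul_two_pi,
      Real.sin_add_nat_mul_two_pi, Real.sin_sub_int_mul_two_pi]
    exact hϑ
  -- The first turn along the ray of `p` with radius at most `‖p‖` is not turn `0`, by the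
  -- hypothesis on `ρ`. So `p` lies between it and the preceding turn, whose distance is less than
  -- `ε`.
  have hex : ∃ m : ℕ, spiralRadius n G φ₀ (a + m * (2 * Real.pi)) ≤ ‖p‖ := by
    have ht : Tendsto (fun m : ℕ => a + m * (2 * Real.pi)) atTop atTop :=
      tendsto_atTop_add_const_left _ _
        (tendsto_natCast_atTop_atTop.atTop_mul_const (by positivity))
    obtain ⟨m, hm⟩ := ((hlim.comp ht).eventually (gt_mem_nhds (norm_pos_iff.2 hp0))).exists
    exact ⟨m, le_of_lt hm⟩
  classical
  obtain ⟨m, hm⟩ : ∃ m, Nat.find hex = m + 1 := by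
    refine Nat.exists_eq_succ_of_ne_zero fun h0 => ?_
    have := Nat.find_spec hex
    rw [h0] at this
    have h2 := hρ a (Ico_subset_Icc_self haI)
    simp only [Nat.cast_zero, zero_mul, add_zero] at this
    linarith
  have hspec := Nat.find_spec hex
  rw [hm] at hspec
  have hprev := not_le.1 (Nat.find_min hex (m := m) (by omega))
  have hb1 : φ₁ ≤ a + m * (2 * Real.pi) := by
    have : 0 ≤ (m : ℝ) * (2 * Real.pi) := by positivity
    linarith [haI.1]
  have hg := hgap _ hb1
  have e : a + ((m + 1 : ℕ) : ℝ) * (2 * Real.pi) = a + m * (2 * Real.pi) + 2 * Real.pi := by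
    push_cast; ring
  rw [e] at hspec
  refine ⟨_, mem_image_of_mem _ (mem_Ici.2 (hφ₁.trans hb1)), ?_⟩
  refine lt_of_le_of_lt (le_of_eq ?_) (lt_of_le_of_lt (sub_le_sub_left hspec _) hg)
  have hdist : ∀ r s φ : ℝ, dist (polarPoint r φ) (polarPoint s φ) ^ 2 = (s - r) ^ 2 := by
    intro r s φ
    rw [dist_sq_plane, polarPoint_zero, polarPoint_zero, polarPoint_one, polarPoint_one]
    linear_combination (s - r) ^ 2 * Real.cos_sq_add_sin_sq φ
  refine (pow_left_inj₀ dist_nonneg (by linarith) two_ne_zero).1 ?_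
  rw [spiralCurve, ← hdist ‖p‖ _ (a + m * (2 * Real.pi)), ← hpa m]

theorem exists_le_volume_thickening_pow {n k : ℕ} {G : ℝ → ℝ} (hn : Odd n)
    (hG : IsRadialProfile k G) {φ₀ α A D : ℝ} (hα0 : 0 < α) (hA : 0 < A) (hD : 0 < D)
    (hf : ∀ φ, φ₀ ≤ φ → A * (φ - φ₀ + 1) ^ (-α) ≤ spiralRadius n G φ₀ φ)
    (hgap : ∀ φ, φ₀ ≤ φ → spiralRadius n G φ₀ φ - spiralRadius n G φ₀ (φ + 2 * Real.pi) ≤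
      D * (φ - φ₀ + 1) ^ (-(1 + α))) :
    ∃ c : ℝ, 0 < c ∧ ∀ ε, 0 < ε → ε < D →
      ENNReal.ofReal (c * ε ^ (2 * (α / (1 + α)))) ≤
        volume (Metric.thickening ε (spiralCurve n G φ₀ '' Ici φ₀)) := by
  have hpi := Real.pi_pos
  have hα1' : 0 < 1 + α := by linarith
  set β := α / (1 + α) with hβ
  refine ⟨(A * (1 + 2 * Real.pi) ^ (-α) * ((2 * D) ^ β)⁻¹) ^ 2 * Real.pi, by positivity,
    fun ε hε hεD => ?_⟩
  -- The factor `2` makes the gap bound at the cut equal to `ε / 2`, hence strictly below `ε`.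
  set X := (ε / (2 * D)) ^ (-(1 / (1 + α))) with hX
  have hq : 0 < ε / (2 * D) := by positivity
  have hX1 : 1 ≤ X := Real.one_le_rpow_of_pos_of_le_one_of_nonpos hq
    (by rw [div_le_one (by positivity)]; linarith) (by rw [neg_nonpos]; positivity)
  have hXα : X ^ (-α) = (ε / (2 * D)) ^ β := by
    rw [hX, ← Real.rpow_mul hq.le]; congr 1; rw [hβ]; field_simp
  have hXg : D * X ^ (-(1 + α)) = ε / 2 := by
    rw [hX, ← Real.rpow_mul hq.le, show -(1 / (1 + α)) * -(1 + α) = 1 by field_simp, Real.rpow_one]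
    field_simp
  -- On the first turn after the cut `φ - φ₀ + 1 ≤ X + 2π ≤ (1 + 2π) X`, since `X ≥ 1`. This gives
  -- the radius of the disc.
  have hsub := ball_subset_thickening_spiralCurve hn hG (φ₀ := φ₀) (φ₁ := φ₀ - 1 + X)
    (ρ := A * ((1 + 2 * Real.pi) * X) ^ (-α)) (ε := ε) (by linarith) hε
    (fun φ hφ => by
      refine le_trans ?_ (hf φ (by linarith [hφ.1]))
      refine mul_le_mul_of_nonneg_left ?_ hA.le
      refine Real.rpow_le_rpow_of_nonpos (by linarith [hφ.1]) ?_ (by linarith)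
      nlinarith [hφ.2])
    (fun φ hφ => by
      refine lt_of_le_of_lt (hgap φ (by linarith)) ?_
      have : (φ - φ₀ + 1) ^ (-(1 + α)) ≤ X ^ (-(1 + α)) :=
        Real.rpow_le_rpow_of_nonpos (by linarith) (by linarith) (by linarith)
      have := mul_le_mul_of_nonneg_left this hD.le
      linarith)
  refine le_trans (le_of_eq ?_) (measure_mono hsub)
  rw [EuclideanSpace.volume_ball_fin_two, ← ENNReal.ofReal_pow (by positivity),
    ← ENNReal.ofReal_mul (by positivity)]
  congr 1
  have hsq : ε ^ (2 * β) = (ε ^ β) ^ 2 := by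
    rw [← Real.rpow_natCast, ← Real.rpow_mul hε.le]; congr 1; push_cast; ring
  rw [Real.mul_rpow (x := 1 + 2 * Real.pi) (y := X) (by positivity) (by positivity), hXα,
    Real.div_rpow hε.le (by positivity), hsq]
  ring

theorem minkowski_spiralCurve_pow {n k : ℕ} (hn : Odd n) (hk : 0 < k) {a : ℝ} (ha : 0 < a)
    (φ₀ : ℝ) :
    HasBoxDim (spiralCurve n (powProfile k a) φ₀ '' Ici φ₀) (2 - 2 / (1 + 2 * k * n : ℝ)) ∧
      IsMinkowskiNondegenerate (spiralCurve n (powProfile k a) φ₀ '' Ici φ₀) := by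
  have hn1 : (1 : ℝ) ≤ n := by exact_mod_cast hn.pos
  have hk1 : (1 : ℝ) ≤ k := by exact_mod_cast hk
  have hk0 : (0 : ℝ) < k := by linarith
  have hpi := Real.pi_pos
  have hG := isRadialProfile_powProfile hk ha
  obtain ⟨A, B, hA, hB, hAB⟩ := exists_spiralRadius_pow_bounds hn hk ha φ₀
  obtain ⟨c, C, hc, hC, hcC⟩ := exists_base_bounds hn hk ha φ₀
  set α : ℝ := 1 / (2 * n * k : ℝ) with hα
  have hα0 : 0 < α := by positivity
  have hα1 : α < 1 := by
    rw [hα, div_lt_one (by positivity)]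
    nlinarith
  have hexp : ((2 : ℕ) : ℝ) - (2 - 2 / (1 + 2 * k * n : ℝ)) = 2 * (α / (1 + α)) := by
    rw [hα]; push_cast; field_simp; ring
  have hd0 : (0 : ℝ) ≤ 2 - 2 / (1 + 2 * k * n : ℝ) := by
    rw [sub_nonneg, div_le_iff₀ (by positivity)]
    nlinarith [mul_pos hk0 (show (0 : ℝ) < n by linarith)]
  obtain ⟨C₁, hC₁, hup⟩ := exists_volume_thickening_pow_le hn hG hα0 hα1 hB
    fun φ hφ => (hAB φ hφ).2
  have hD : 0 < B * (4 * Real.pi * k / c) := by positivity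
  obtain ⟨c₁, hc₁, hlow⟩ := exists_le_volume_thickening_pow hn hG hα0 hA hD
    (fun φ hφ => (hAB φ hφ).1) (fun φ hφ => by
      refine (spiralRadius_pow_gap hn hk ha hφ).trans ?_
      have hx : 0 < φ - φ₀ + 1 := by linarith
      have hr := spiralRadius_pos hn hG hφ
      have h1 := (hAB φ hφ).2
      have h2 := (hcC φ hφ).1
      have hb : 0 < a + 2 * k * generalizedAngle n φ₀ φ := lt_of_lt_of_le (by positivity) h2
      calc _ ≤ B * (φ - φ₀ + 1) ^ (-α) * (4 * Real.pi * k / (c * (φ - φ₀ + 1))) := by gcongr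
        _ = _ := by
          rw [neg_add_rev, Real.rpow_add hx, Real.rpow_neg_one]
          field_simp)
  have hlower : 0 < lowerMinkowskiContent (2 - 2 / (1 + 2 * k * n : ℝ))
      (spiralCurve n (powProfile k a) φ₀ '' Ici φ₀) := by
    refine lowerMinkowskiContent_pos_of_le hc₁ ?_
    filter_upwards [Ioo_mem_nhdsGT hD] with ε hε
    rw [hexp]
    exact hlow ε hε.1 hε.2
  have hupper : upperMinkowskiContent (2 - 2 / (1 + 2 * k * n : ℝ))
      (spiralCurve n (powProfile k a) φ₀ '' Ici φ₀) < ∞ := by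
    refine upperMinkowskiContent_lt_top_of_le hC₁ ?_
    filter_upwards [Ioo_mem_nhdsGT (zero_lt_one' ℝ)] with ε hε
    rw [hexp]
    exact hup ε hε.1 hε.2
  exact ⟨hasBoxDim_of_contents (isBounded_spiralCurve hn hG φ₀) hd0 hlower hupper, _, hd0, hlower,
    lowerMinkowskiContent_le_upper _ _, hupper⟩

/-! ### Assembly for the stable focus -/

/-- Every point off the origin lies on one of the explicit spirals. -/
theorem exists_profile_exp {n : ℕ} (hn : Odd n) {p : EuclideanSpace ℝ (Fin 2)} (hp : p ≠ 0)
    {φ₀ : ℝ} (hφ₀ : p = polarPoint ‖p‖ φ₀) :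
    ∃ H : ℝ, 0 < H ∧ spiralRadius n (expProfile H) φ₀ φ₀ = ‖p‖ ∧
      p = spiralCurve n (expProfile H) φ₀ φ₀ := by
  have hr : 0 < ‖p‖ := norm_pos_iff.2 hp
  have hh := angularNorm_pos n φ₀
  have h0 : spiralRadius n (expProfile (‖p‖ ^ (2 * n) * angularNorm n φ₀)) φ₀ φ₀ = ‖p‖ :=
    spiralRadius_initial hn hr.le (by simp [expProfile])
  exact ⟨_, by positivity, h0, by rw [spiralCurve, h0]; exact hφ₀⟩

theorem exists_profile_pow {n k : ℕ} (hn : Odd n) (hk : 0 < k) {p : EuclideanSpace ℝ (Fin 2)}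
    (hp : p ≠ 0) {φ₀ : ℝ} (hφ₀ : p = polarPoint ‖p‖ φ₀) :
    ∃ a : ℝ, 0 < a ∧ spiralRadius n (powProfile k a) φ₀ φ₀ = ‖p‖ ∧
      p = spiralCurve n (powProfile k a) φ₀ φ₀ := by
  have hr : 0 < ‖p‖ := norm_pos_iff.2 hp
  have hh := angularNorm_pos n φ₀
  have hH : 0 < ‖p‖ ^ (2 * n) * angularNorm n φ₀ := by positivity
  -- The constant `a` is `H^(-k)`, with `H` the value of the first integral at `p`.
  have h0 : spiralRadius n (powProfile k ((‖p‖ ^ (2 * n) * angularNorm n φ₀) ^ k)⁻¹) φ₀ φ₀ =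
      ‖p‖ := by
    refine spiralRadius_initial hn hr.le ?_
    rw [powProfile, mul_zero, add_zero, Real.inv_rpow (by positivity), Real.rpow_neg (by positivity),
      inv_inv, Real.pow_rpow_inv_natCast hH.le hk.ne']
  exact ⟨_, by positivity, h0, by rw [spiralCurve, h0]; exact hφ₀⟩

/-- The assertions about the stable focus. -/
theorem stable_focus (n k : ℕ) (hn : Odd n) (J : Set ℝ) (γ : ℝ → EuclideanSpace ℝ (Fin 2)) (t₀ : ℝ)
    (h : IsMaximalSolution (field n k (-1)) J γ) (ht₀ : t₀ ∈ J) (h0 : γ t₀ ≠ 0) :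
    Ici t₀ ⊆ J ∧
    (k = 0 →
      (∀ φ₀ : ℝ, γ t₀ = polarPoint ‖γ t₀‖ φ₀ →
        ∃ f : ℝ → ℝ, f φ₀ = ‖γ t₀‖ ∧ IsPosFocusSpiral (γ '' Ici t₀) φ₀ f ∧
          PosComparableExp φ₀ f (1 / (n : ℝ))) ∧
      HasBoxDim (γ '' Ici t₀) 1 ∧ IsMinkowskiMeasurable (γ '' Ici t₀)) ∧
    (0 < k →
      (∀ φ₀ : ℝ, γ t₀ = polarPoint ‖γ t₀‖ φ₀ →
        ∃ f : ℝ → ℝ, f φ₀ = ‖γ t₀‖ ∧ IsPosFocusSpiral (γ '' Ici t₀) φ₀ f ∧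
          PosComparablePower φ₀ f (1 / (2 * n * k : ℝ))) ∧
      HasBoxDim (γ '' Ici t₀) (2 - 2 / (1 + 2 * k * n : ℝ)) ∧
      IsMinkowskiNondegenerate (γ '' Ici t₀)) := by
  -- Statements about the set itself do not involve the polar angle, so any one angle serves for
  -- them.
  obtain ⟨φ₁, hφ₁⟩ := exists_polarPoint_eq (γ t₀)
  rcases Nat.eq_zero_or_pos k with rfl | hk
  · have key : ∀ φ₀, γ t₀ = polarPoint ‖γ t₀‖ φ₀ → ∃ H : ℝ, 0 < H ∧
        spiralRadius n (expProfile H) φ₀ φ₀ = ‖γ t₀‖ ∧ Ici t₀ ⊆ J ∧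
        γ '' Ici t₀ = spiralCurve n (expProfile H) φ₀ '' Ici φ₀ := by
      intro φ₀ hφ₀
      obtain ⟨H, hH, hr, hp⟩ := exists_profile_exp hn h0 hφ₀
      exact ⟨H, hH, hr, forward_trajectory hn (isRadialProfile_expProfile hH) h ht₀ hp⟩
    obtain ⟨H, hH, -, hJ, himg⟩ := key φ₁ hφ₁
    refine ⟨hJ, fun _ => ⟨fun φ₀ hφ₀ => ?_, ?_⟩, fun hk => absurd hk (lt_irrefl 0)⟩
    · obtain ⟨H, hH, hr, -, himg⟩ := key φ₀ hφ₀
      refine ⟨_, hr, ?_, posComparableExp_spiralRadius hn hH φ₀⟩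
      rw [himg]
      exact isPosFocusSpiral_spiralCurve hn (isRadialProfile_expProfile hH) φ₀
    · rw [himg]
      exact minkowski_spiralCurve_exp hn hH φ₁
  · have key : ∀ φ₀, γ t₀ = polarPoint ‖γ t₀‖ φ₀ → ∃ a : ℝ, 0 < a ∧
        spiralRadius n (powProfile k a) φ₀ φ₀ = ‖γ t₀‖ ∧ Ici t₀ ⊆ J ∧
        γ '' Ici t₀ = spiralCurve n (powProfile k a) φ₀ '' Ici φ₀ := by
      intro φ₀ hφ₀
      obtain ⟨a, ha, hr, hp⟩ := exists_profile_pow hn hk h0 hφ₀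
      exact ⟨a, ha, hr, forward_trajectory hn (isRadialProfile_powProfile hk ha) h ht₀ hp⟩
    obtain ⟨a, ha, -, hJ, himg⟩ := key φ₁ hφ₁
    refine ⟨hJ, fun hk0 => absurd hk0 hk.ne', fun _ => ⟨fun φ₀ hφ₀ => ?_, ?_⟩⟩
    · obtain ⟨a, ha, hr, -, himg⟩ := key φ₀ hφ₀
      refine ⟨_, hr, ?_, posComparablePower_spiralRadius hn hk ha φ₀⟩
      rw [himg]
      exact isPosFocusSpiral_spiralCurve hn (isRadialProfile_powProfile hk ha) φ₀
    · rw [himg]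
      exact minkowski_spiralCurve_pow hn hk ha φ₁

/-! ### Reduction of the unstable focus to the stable one -/

/-- The reflection `(x, y) ↦ (x, -y)`. -/
noncomputable def reflection : EuclideanSpace ℝ (Fin 2) ≃ₗᵢ[ℝ] EuclideanSpace ℝ (Fin 2) :=
  LinearIsometryEquiv.piLpCongrRight 2
    (fun i : Fin 2 => if i = 0 then LinearIsometryEquiv.refl ℝ ℝ else LinearIsometryEquiv.neg ℝ)

theorem reflection_zero (p : EuclideanSpace ℝ (Fin 2)) : reflection p 0 = p 0 := by
  simp [reflection]

theorem reflection_one (p : EuclideanSpace ℝ (Fin 2)) : reflection p 1 = -p 1 := by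
  simp [reflection]

theorem reflection_reflection (p : EuclideanSpace ℝ (Fin 2)) : reflection (reflection p) = p := by
  ext i
  fin_cases i
  · simp [reflection_zero]
  · simp [reflection_one]

theorem reflection_polarPoint (r φ : ℝ) : reflection (polarPoint r φ) = polarPoint r (-φ) := by
  ext i
  fin_cases i
  · simp [reflection_zero, polarPoint_zero]
  · simp [reflection_one, polarPoint_one]

/-- The reflection carries the unperturbed field to its negative because `2n - 1` is odd, and
commutes with the radial perturbation because `n - 1` is even. Time reversal therefore flips the
sign `σ`. -/
theorem field_reflection {n : ℕ} (hn : Odd n) (k : ℕ) (σ : ℝ) (p : EuclideanSpace ℝ (Fin 2)) :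
    field n k (-σ) (reflection p) = -reflection (field n k σ p) := by
  have h1 : Odd (2 * n - 1) := ⟨n - 1, by have := hn.pos; omega⟩
  have h2 : Even (n - 1) := Nat.Odd.sub_odd hn odd_one
  have h3 : Even (2 * n) := even_two_mul n
  ext i
  fin_cases i
  · simp only [Fin.zero_eta, PiLp.neg_apply, reflection_zero]
    simp only [field, reflection_zero, reflection_one, h1.neg_pow, h2.neg_pow, h3.neg_pow,
      Matrix.cons_val_zero]
    ring
  · simp only [Fin.mk_one, PiLp.neg_apply, reflection_one]
    simp only [field, reflection_zero, reflection_one, hn.neg_pow, h3.neg_pow,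
      Matrix.cons_val_one, Matrix.cons_val_fin_one]
    ring

/-- Reflection in the `x`-axis combined with time reversal. -/
noncomputable def reverse (γ : ℝ → EuclideanSpace ℝ (Fin 2)) (t : ℝ) : EuclideanSpace ℝ (Fin 2) :=
  reflection (γ (-t))

theorem IsSolutionOn.reverse {n : ℕ} (hn : Odd n) {k : ℕ} {σ : ℝ} {J : Set ℝ}
    {γ : ℝ → EuclideanSpace ℝ (Fin 2)} (h : IsSolutionOn (field n k σ) J γ) :
    IsSolutionOn (field n k (-σ)) (Neg.neg ⁻¹' J) (reverse γ) := by
  refine ⟨h.isOpen.preimage continuous_neg, ⟨fun x hx y hy z hz => ?_⟩, fun t ht => ?_⟩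
  · exact h.ordConnected.out hy hx ⟨neg_le_neg hz.2, neg_le_neg hz.1⟩
  · have h1 := (h.hasDerivAt (-t) ht).scomp t (hasDerivAt_neg t)
    have h2 := reflection.toContinuousLinearEquiv.hasFDerivAt.comp_hasDerivAt t h1
    refine h2.congr_deriv ?_
    rw [DegenerateFocus.reverse, field_reflection hn]
    simp

/-- The reversal is an involution, so an extension of the reversed solution reverses to an extension
of the original one. -/
theorem IsMaximalSolution.reverse {n : ℕ} (hn : Odd n) {k : ℕ} {σ : ℝ} {J : Set ℝ}
    {γ : ℝ → EuclideanSpace ℝ (Fin 2)} (h : IsMaximalSolution (field n k σ) J γ) :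
    IsMaximalSolution (field n k (-σ)) (Neg.neg ⁻¹' J) (reverse γ) := by
  refine ⟨h.isSolutionOn.reverse hn, fun J' γ' hs hJ heq => ?_⟩
  have hs' := hs.reverse hn
  rw [neg_neg] at hs'
  have hsub := h.maximal _ _ hs' (fun t ht => hJ (by simpa using ht)) (fun t ht => by
    rw [DegenerateFocus.reverse, heq (show -t ∈ Neg.neg ⁻¹' J by simpa using ht),
      DegenerateFocus.reverse, reflection_reflection, neg_neg])
  exact fun t ht => hsub (show -t ∈ Neg.neg ⁻¹' J' by simpa using ht)

theorem image_reverse (γ : ℝ → EuclideanSpace ℝ (Fin 2)) (t₀ : ℝ) :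
    reflection '' (reverse γ '' Ici (-t₀)) = γ '' Iic t₀ := by
  rw [← image_comp, ← neg_neg t₀, ← image_neg_Ici, neg_neg, ← image_comp]
  refine image_congr fun t _ => ?_
  rw [Function.comp_apply, reverse, reflection_reflection, Function.comp_apply]

theorem IsPosFocusSpiral.reflection {Γ : Set (EuclideanSpace ℝ (Fin 2))} {φ₀ : ℝ} {f : ℝ → ℝ}
    (h : IsPosFocusSpiral Γ (-φ₀) f) :
    IsNegFocusSpiral (DegenerateFocus.reflection '' Γ) φ₀ (fun φ => f (-φ)) where
  continuousOn := h.continuousOn.comp continuous_neg.continuousOn fun _ hφ => mem_Ici.2 (neg_le_neg hφ)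
  pos φ hφ := h.pos _ (mem_Ici.2 (neg_le_neg hφ))
  decreasing φ hφ := by
    rw [neg_sub, sub_eq_neg_add]
    exact h.decreasing _ (mem_Ici.2 (neg_le_neg hφ))
  tendsto := h.tendsto.comp tendsto_neg_atBot_atTop
  eq_image := by
    rw [h.eq_image, ← image_neg_Iic, ← image_comp, ← image_comp]
    refine image_congr fun φ _ => ?_
    rw [Function.comp_apply, Function.comp_apply, reflection_polarPoint, neg_neg]

end DegenerateFocus

open DegenerateFocus in
theorem theorem3p1 (n k : ℕ) (hn : Odd n) :
    (∀ (J : Set ℝ) (γ : ℝ → EuclideanSpace ℝ (Fin 2)) (t₀ : ℝ),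
      IsMaximalSolution (field n k (-1)) J γ → t₀ ∈ J → γ t₀ ≠ 0 →
        Ici t₀ ⊆ J ∧
        (k = 0 →
          (∀ φ₀ : ℝ, γ t₀ = polarPoint ‖γ t₀‖ φ₀ →
            ∃ f : ℝ → ℝ, f φ₀ = ‖γ t₀‖ ∧ IsPosFocusSpiral (γ '' Ici t₀) φ₀ f ∧
              PosComparableExp φ₀ f (1 / (n : ℝ))) ∧
          HasBoxDim (γ '' Ici t₀) 1 ∧ IsMinkowskiMeasurable (γ '' Ici t₀)) ∧
        (0 < k →
          (∀ φ₀ : ℝ, γ t₀ = polarPoint ‖γ t₀‖ φ₀ →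
            ∃ f : ℝ → ℝ, f φ₀ = ‖γ t₀‖ ∧ IsPosFocusSpiral (γ '' Ici t₀) φ₀ f ∧
              PosComparablePower φ₀ f (1 / (2 * n * k : ℝ))) ∧
          HasBoxDim (γ '' Ici t₀) (2 - 2 / (1 + 2 * k * n : ℝ)) ∧
          IsMinkowskiNondegenerate (γ '' Ici t₀))) ∧
    (∀ (J : Set ℝ) (γ : ℝ → EuclideanSpace ℝ (Fin 2)) (t₀ : ℝ),
      IsMaximalSolution (field n k 1) J γ → t₀ ∈ J → γ t₀ ≠ 0 →
        Iic t₀ ⊆ J ∧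
        (k = 0 →
          (∀ φ₀ : ℝ, γ t₀ = polarPoint ‖γ t₀‖ φ₀ →
            ∃ f : ℝ → ℝ, f φ₀ = ‖γ t₀‖ ∧ IsNegFocusSpiral (γ '' Iic t₀) φ₀ f ∧
              NegComparableExp φ₀ f (-(1 / (n : ℝ)))) ∧
          HasBoxDim (γ '' Iic t₀) 1 ∧ IsMinkowskiMeasurable (γ '' Iic t₀)) ∧
        (0 < k →
          (∀ φ₀ : ℝ, γ t₀ = polarPoint ‖γ t₀‖ φ₀ →
            ∃ f : ℝ → ℝ, f φ₀ = ‖γ t₀‖ ∧ IsNegFocusSpiral (γ '' Iic t₀) φ₀ f ∧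
              NegComparablePower φ₀ f (1 / (2 * n * k : ℝ))) ∧
          HasBoxDim (γ '' Iic t₀) (2 - 2 / (1 + 2 * k * n : ℝ)) ∧
          IsMinkowskiNondegenerate (γ '' Iic t₀))) := by

  refine ⟨fun J γ t₀ h ht₀ h0 => stable_focus n k hn J γ t₀ h ht₀ h0, fun J γ t₀ h ht₀ h0 => ?_⟩
  have ht : -t₀ ∈ Neg.neg ⁻¹' J := by simpa using ht₀
  have hrev : reverse γ (-t₀) = reflection (γ t₀) := by rw [reverse, neg_neg]
  have hne : reverse γ (-t₀) ≠ 0 := by rwa [hrev, Ne, map_eq_zero_iff _ reflection.injective]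
  have hnorm : ‖reverse γ (-t₀)‖ = ‖γ t₀‖ := by rw [hrev, reflection.norm_map]
  -- Reflection negates polar angles, which is why the spiral radius on `(-∞, φ₀]` is `f (-φ)` for
  -- the stable `f` on `[-φ₀, ∞)`.
  have hpolar : ∀ φ₀, γ t₀ = polarPoint ‖γ t₀‖ φ₀ →
      reverse γ (-t₀) = polarPoint ‖reverse γ (-t₀)‖ (-φ₀) := fun φ₀ hφ₀ => by
    rw [hnorm, hrev, ← reflection_polarPoint, ← hφ₀]
  obtain ⟨hJ, hexp, hpow⟩ := stable_focus n k hn _ _ _ (h.reverse hn) ht hne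
  rw [← image_reverse γ t₀]
  refine ⟨fun t htt => by simpa using hJ (neg_le_neg htt : -t₀ ≤ -t), fun hk => ?_, fun hk => ?_⟩
  · obtain ⟨hf, hdim, hmeas⟩ := hexp hk
    refine ⟨fun φ₀ hφ₀ => ?_, hdim.image_isometry reflection, hmeas.image_isometry reflection⟩
    obtain ⟨f, hf0, hsp, hβ, A, B, hA, hB, hAB⟩ := hf (-φ₀) (hpolar φ₀ hφ₀)
    refine ⟨fun φ => f (-φ), hf0.trans hnorm, hsp.reflection, neg_lt_zero.2 hβ,
      A, B, hA, hB, fun φ hφ => ?_⟩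
    have := hAB (-φ) ⟨mem_Ici.2 (neg_le_neg hφ.1), mem_Ici.2 (neg_nonneg.2 hφ.2)⟩
    simpa using this
  · obtain ⟨hf, hdim, hmink⟩ := hpow hk
    refine ⟨fun φ₀ hφ₀ => ?_, hdim.image_isometry reflection, hmink.image_isometry reflection⟩
    obtain ⟨f, hf0, hsp, A, B, hA, hB, hAB⟩ := hf (-φ₀) (hpolar φ₀ hφ₀)
    refine ⟨fun φ => f (-φ), hf0.trans hnorm, hsp.reflection, A, B, hA, hB, fun φ hφ => ?_⟩
    have := hAB (-φ) ⟨mem_Ici.2 (neg_le_neg hφ.1), mem_Ici.2 (le_neg.1 hφ.2)⟩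
    simpa only [abs_neg] using this
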